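/- Let $p$ be an odd prime. For $a\in\mathbb Z$ and an integer $j\ge 0$ let $\binom aj$ be the usual binomial coefficient if $a\ge 0$, and $\binom aj=0$ if $a<0$. Let $\mathcal Q(p)$ be the universal Steenrod algebra, i.e. the associative unital $\mathbb F_p$-algebra generated by $z_{\epsilon,k}$ ($\epsilon\in\{0,1\}$, $k\in\mathbb Z$) subject to the generalized Adem relations $R(\epsilon,k,n)=0$ and $S(\epsilon,k,n)=0$ for all $\epsilon\in\{0,1\}$, $k\in\mathbb Z$, $n\ge 0$, where $$R(\epsilon,k,n)=z_{\epsilon,pk-1-n}z_{0,k}+\sum_{j\ge 0}(-1)^j\binom{(p-1)(n-j)-1}{j}z_{\epsilon,pk-1-j}z_{0,k-n+j},$$ $$S(\epsilon,k,n)=z_{\epsilon,pk-n}z_{1,k}+\sum_{j\ge 0}(-1)^{j}\binom{(p-1)(n-j)-1}{j}z_{\epsilon,pk-j}z_{1,k-n+j}+(1-\epsilon)\sum_{j\ge 0}(-1)^{j+1}\binom{(p-1)(n-j)}{j}z_{1,pk-j}z_{0,k-n+j}.$$ For $s\ge 0$ put $\alpha_s=\frac{p^s-1}{p-1}$. Let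 $\mathcal Q^0_s\subseteq\mathcal Q(p)$ be the unital subalgebra generated by all $z_{0,p^sh-\alpha_s}$, $h\in\mathbb Z$, and let $V_s\subseteq\mathcal Q(p)$ be the $\mathbb F_p$-span of all monomials $$z_{1,p^sh_1-\alpha_s}z_{0,p^sh_2-\alpha_s}\cdots z_{0,p^sh_m-\alpha_s}\qquad (m\ge 2,\ (h_1,\dots,h_m)\in\mathbb Z^m),$$ which is a right $\mathcal Q^0_s$-module under the multiplication of $\mathcal Q(p)$. Let $\mathcal K$ be the category whose objects are the pairs $(M,R)$ with $R$ a ring and $M$ a right $R$-module, and whose morphisms $(M,R)\to(N,S)$ are the pairs $(f,\omega)$ of a group homomorphism $f:M\to N$ and a ring homomorphism $\omega:R\to S$ with $f(mr)=f(m)\,\omega(r)$ for all $m\in M$, $r\in R$. Theorem 4.3. The pairs $(V_s,\mathcal Q^0_s)$, $s\ge 0$, form a descending chain in $\mathcal K$, $$(V_0,\mathcal Q^0_0)\supset(V_1,\mathcal Q^0_1)\supset\cdots\supset(V_s,\mathcal Q^0_s)\supset(V_{s+1},\mathcal Q^0_{s+1})\supset\cdots$$ (for every $s$ the inclusions $V_{s+1}\subset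 V_s$ and $\mathcal Q^0_{s+1}\subset\mathcal Q^0_s$ are proper, and together they form a morphism of $\mathcal K$), and all objects of this chain are isomorphic in $\mathcal K$. More precisely, there are an injective $\mathbb F_p$-linear map $\lambda:V_0\to V_0$ and an injective $\mathbb F_p$-algebra homomorphism $\phi:\mathcal Q^0_0\to\mathcal Q^0_0$ with $$\lambda(z_{1,i_1}z_{0,i_2}\cdots z_{0,i_m})=z_{1,pi_1-1}z_{0,pi_2-1}\cdots z_{0,pi_m-1}\quad(m\ge 2,\ i_1,\dots,i_m\in\mathbb Z),\qquad \phi(z_{0,k})=z_{0,pk-1}\quad(k\in\mathbb Z),$$ and for every $s\ge 0$ the pair $(\lambda|_{V_s},\phi|_{\mathcal Q^0_s})$ is an isomorphism $(V_s,\mathcal Q^0_s)\to(V_{s+1},\mathcal Q^0_{s+1})$ in $\mathcal K$. -/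

import Mathlib

open CategoryTheory MulOpposite

noncomputable section

namespace UnivSteenrod

/-! ### The universal Steenrod algebra at an odd prime -/

/-- The free associative unital `𝔽_p`-algebra on the letters `z_{ε,k}`, `ε ∈ {0,1}`, `k ∈ ℤ`. -/
abbrev FreeAlg (p : ℕ) : Type := FreeAlgebra (ZMod p) (Fin 2 × ℤ)

/-- The free generator `z_{ε,k}`. -/
def fz (p : ℕ) (ε : Fin 2) (k : ℤ) : FreeAlg p := FreeAlgebra.ι (ZMod p) (ε, k)

/-- The binomial coefficient `a choose j` for an integer `a`, with the convention that it
vanishes for `a < 0` (and, as usual, for `0 ≤ a < j`). -/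
def ibinom (a : ℤ) (j : ℕ) : ℕ := if 0 ≤ a then a.toNat.choose j else 0

/-- The generalized Adem relation `R(ε,k,n)`. All terms with `j > n` have coefficient `0`, so that
the sum over all `j ≥ 0` is a sum over `0 ≤ j ≤ n`. -/
def relR (p : ℕ) (ε : Fin 2) (k : ℤ) (n : ℕ) : FreeAlg p :=
  fz p ε (p * k - 1 - n) * fz p 0 k +
    ∑ j ∈ Finset.range (n + 1),
      (((-1) ^ j * (ibinom (((p : ℤ) - 1) * ((n : ℤ) - j) - 1) j : ZMod p)) : ZMod p) •
        (fz p ε (p * k - 1 - j) * fz p 0 (k - n + j))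

/-- The generalized Adem relation `S(ε,k,n)`. All terms with `j > n` have coefficient `0`, so that
the sums over all `j ≥ 0` are sums over `0 ≤ j ≤ n`. The last sum is there only for `ε = 0`. -/
def relS (p : ℕ) (ε : Fin 2) (k : ℤ) (n : ℕ) : FreeAlg p :=
  fz p ε (p * k - n) * fz p 1 k +
    ∑ j ∈ Finset.range (n + 1),
      (((-1) ^ j * (ibinom (((p : ℤ) - 1) * ((n : ℤ) - j) - 1) j : ZMod p)) : ZMod p) •
        (fz p ε (p * k - j) * fz p 1 (k - n + j)) +
    if ε = 0 then
      ∑ j ∈ Finset.range (n + 1),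
        (((-1) ^ (j + 1) * (ibinom (((p : ℤ) - 1) * ((n : ℤ) - j)) j : ZMod p)) : ZMod p) •
          (fz p 1 (p * k - j) * fz p 0 (k - n + j))
    else 0

/-- Every `R(ε,k,n)` and every `S(ε,k,n)` is identified with `0`. -/
inductive AdemRel (p : ℕ) : FreeAlg p → FreeAlg p → Prop
  | ofR (ε : Fin 2) (k : ℤ) (n : ℕ) : AdemRel p (relR p ε k n) 0
  | ofS (ε : Fin 2) (k : ℤ) (n : ℕ) : AdemRel p (relS p ε k n) 0

/-- The universal Steenrod algebra `𝒬(p)`: the quotient of the free algebra by the two-sided ideal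
generated by the generalized Adem relations. -/
abbrev Q (p : ℕ) : Type := RingQuot (AdemRel p)

/-- The class of the generator `z_{ε,k}` in `𝒬(p)`. -/
def z (p : ℕ) (ε : Fin 2) (k : ℤ) : Q p := RingQuot.mkAlgHom (ZMod p) (AdemRel p) (fz p ε k)

/-! ### The subalgebras `𝒬_s^0` and the subspaces `V_s` -/

/-- `α_s = (p^s - 1)/(p - 1)`; the division is exact for `p ≥ 2`. -/
def alpha (p s : ℕ) : ℕ := (p ^ s - 1) / (p - 1)

/-- The index `p^s h - α_s`. -/
def idx (p s : ℕ) (h : ℤ) : ℤ := (p : ℤ) ^ s * h - alpha p s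

/-- `𝒬_s^0`, the unital subalgebra of `𝒬(p)` generated by the `z_{0,p^s h - α_s}`, `h ∈ ℤ`. -/
def Q0 (p s : ℕ) : Subalgebra (ZMod p) (Q p) :=
  Algebra.adjoin (ZMod p) (Set.range fun h : ℤ => z p 0 (idx p s h))

/-- For `l = [i₂, …, i_m]`, the monomial `z_{1,i₁} z_{0,i₂} ⋯ z_{0,i_m}`. -/
def mon (p : ℕ) (i₁ : ℤ) (l : List ℤ) : Q p := z p 1 i₁ * (l.map (z p 0)).prod

/-- `V_s`, the `𝔽_p`-span of the monomials `z_{1,p^s h₁ - α_s} z_{0,p^s h₂ - α_s} ⋯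
z_{0,p^s h_m - α_s}` of length `m ≥ 2`; here `l = [h₂, …, h_m]`. -/
def V (p s : ℕ) : Submodule (ZMod p) (Q p) :=
  Submodule.span (ZMod p)
    {x | ∃ (h₁ : ℤ) (l : List ℤ), l ≠ [] ∧ x = mon p (idx p s h₁) (l.map (idx p s))}

theorem idx_zero (p : ℕ) (h : ℤ) : idx p 0 h = h := by simp [idx, alpha]

theorem V_le_V_zero (p s : ℕ) : V p s ≤ V p 0 := by
  refine Submodule.span_mono ?_
  rintro x ⟨h₁, l, hl, rfl⟩
  refine ⟨idx p s h₁, l.map (idx p s), by simpa using hl, ?_⟩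
  simp [idx_zero, Function.comp_def]

theorem Q0_le_Q0_zero (p s : ℕ) : Q0 p s ≤ Q0 p 0 := by
  refine Algebra.adjoin_mono ?_
  rintro x ⟨h, rfl⟩
  exact ⟨idx p s h, by simp [idx_zero]⟩

theorem z_mem_Q0_zero (p : ℕ) (k : ℤ) : z p 0 k ∈ Q0 p 0 :=
  Algebra.subset_adjoin ⟨k, by simp [idx_zero]⟩

theorem mon_mem_V_zero (p : ℕ) (i₁ : ℤ) (l : List ℤ) (hl : l ≠ []) : mon p i₁ l ∈ V p 0 := by
  refine Submodule.subset_span ⟨i₁, l, hl, ?_⟩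
  have h : idx p 0 = id := funext (idx_zero p)
  simp [h]

/-- `V_s` is stable under right multiplication by `𝒬_s^0`. -/
theorem mul_mem_V {p s : ℕ} {v q : Q p} (hv : v ∈ V p s) (hq : q ∈ Q0 p s) : v * q ∈ V p s := by
  induction hq using Algebra.adjoin_induction generalizing v with
  | mem x hx =>
    obtain ⟨h, rfl⟩ := hx
    induction hv using Submodule.span_induction with
    | mem y hy =>
      obtain ⟨h₁, l, hl, rfl⟩ := hy
      exact Submodule.subset_span ⟨h₁, l ++ [h], by simp, by simp [mon, mul_assoc]⟩
    | zero => simp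
    | add x y _ _ hx hy => rw [add_mul]; exact add_mem hx hy
    | smul a x _ hx => rw [smul_mul_assoc]; exact Submodule.smul_mem _ _ hx
  | algebraMap r =>
    rw [← Algebra.commutes, ← Algebra.smul_def]
    exact Submodule.smul_mem _ _ hv
  | add x y _ _ hx hy => rw [mul_add]; exact add_mem (hx hv) (hy hv)
  | mul x y _ _ hx hy => rw [← mul_assoc]; exact hy (hx hv)

/-- The right `𝒬_s^0`-module structure of `V_s`, given by multiplication in `𝒬(p)`. -/
instance moduleV (p s : ℕ) : Module (Q0 p s)ᵐᵒᵖ (V p s) where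
  smul q v := ⟨(v : Q p) * (q.unop : Q p), mul_mem_V v.2 q.unop.2⟩
  one_smul _ := Subtype.ext (mul_one _)
  mul_smul _ _ _ := Subtype.ext (mul_assoc _ _ _).symm
  smul_zero _ := Subtype.ext (zero_mul _)
  smul_add _ _ _ := Subtype.ext (add_mul _ _ _)
  add_smul _ _ _ := Subtype.ext (mul_add _ _ _)
  zero_smul _ := Subtype.ext (mul_zero _)

theorem coe_op_smul {p s : ℕ} (q : Q0 p s) (v : V p s) :
    ((op q • v : V p s) : Q p) = (v : Q p) * (q : Q p) := rfl

end UnivSteenrod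

/-! ### The category of pairs (right module, ring) -/

universe u v

/-- An object of the category `𝒦`: a ring `R` together with a right `R`-module `M`. -/
structure RightModPair where
  M : Type u
  R : Type v
  [grp : AddCommGroup M]
  [rng : Ring R]
  [mod : Module Rᵐᵒᵖ M]

namespace RightModPair

attribute [instance] grp rng mod

/-- A morphism `(f, ω) : (M, R) → (N, S)`: a group homomorphism `f` and a ring homomorphism `ω`
with `f (m r) = f m · ω r`. -/
@[ext]
structure Hom (X Y : RightModPair.{u, v}) where
  f : X.M →+ Y.M
  ω : X.R →+* Y.R
  map_smul : ∀ (m : X.M) (r : X.R), f (op r • m) = op (ω r) • f m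

instance : Category RightModPair.{u, v} where
  Hom := Hom
  id X := ⟨AddMonoidHom.id _, RingHom.id _, fun _ _ => rfl⟩
  comp a b := ⟨b.f.comp a.f, b.ω.comp a.ω, fun m r => by simp [a.map_smul, b.map_smul]⟩

end RightModPair

namespace UnivSteenrod

/-- The object `(V_s, 𝒬_s^0)` of `𝒦`. -/
def pair (p s : ℕ) : RightModPair.{0, 0} where
  M := V p s
  R := Q0 p s

end UnivSteenrod

end

open UnivSteenrod

/-!
All relations of `𝒬(p)` are homogeneous in the number of letters `z_{1,k}`, and everything happens in
the parts with none and with one such letter at the front.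

* Killing all `z_{1,k}` and sending `z_{0,k}` to `z_{0,pk-1}` is an endomorphism `phiQ` of `𝒬(p)`:
  by Lucas' congruence it maps the relation `R(0,k,n)` to `R(0,pk-1,pn)`.
* The first letter of a monomial may be changed freely between `z_{0,k}` and `z_{1,k}`. In one
  direction (`raiseHead`) this is an entry of a homomorphism to `2 × 2` matrices, which exists because
  `R(1,k,n)` has the same coefficients as `R(0,k,n)`. In the other (`lowerHead`) it is the `ε`-part of
  a homomorphism to the dual numbers `𝒬(p)[ε]` with `z_{1,k} ↦ z_{0,k} ε`; here Pascal's rule turns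
  `S(0,k,n+1)` into `R(0,k,n) ε`. Hence `lamQ = raiseHead ∘ phiQ ∘ lowerHead` is the map `λ`, and it is
  injective on `V_0` as soon as `phiQ` is injective on `𝒬_0^0`.
* `phiQ` is injective on `𝒬_0^0` because the admissible words `z_{0,i₁} ⋯ z_{0,i_m}`, those with
  `i_l ≥ p i_{l+1}`, form a basis, and `phiQ` sends them to different admissible words.

That admissible words span (`Q0_zero_le_admissibleSpan`) is a terminating rewriting argument. For their
independence (`linearIndependent_word`), `𝔽_p[w₁, w₂, …]` carries operations `P_k` whose generating
series is the composition of a generic polynomial in the Frobenius with `1 + v F`. Two successive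
compositions depend only on `u + v` and `u v ^ p`, and for these the Adem relation is the binomial
identity `sum_ademCoeff_mul_choose`. Shifting the indices of the operations allows for words with
negative letters. A monomial in the `w_r` then detects the lexicographically smallest admissible word
of a linear combination.

The inclusions are proper since the character `zeroChar`, which only sees `z_{0,0}`, distinguishes
`s = 0` from `s = 1`; the injective maps `lamQ` and `phiQ` carry this to all `s`.
-/

/-! ### A binomial identity modulo `p` -/

namespace UnivSteenrod

/-- The coefficient of the `j`-th term of the first sum in `R(ε,k,n)` and in `S(ε,k,n)`. -/
noncomputable def ademCoeff (p n j : ℕ) : ZMod p :=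
  (-1) ^ j * (ibinom (((p : ℤ) - 1) * ((n : ℤ) - j) - 1) j : ZMod p)

section Binomial

open PowerSeries Finset

variable (p : ℕ)

/-- The power series `(1 - X) ^ ((p - 1) i - 1)`, including the negative exponent `-1` at `i = 0`. -/
noncomputable def ademSeries (i : ℕ) : PowerSeries (ZMod p) :=
  if i = 0 then PowerSeries.mk 1 else (1 - PowerSeries.X) ^ ((p - 1) * i - 1)

/-- The coefficient of `y ^ n` in the expansion of `1 / (1 - (1 + x) y + x y ^ (p + 1))`, a power
series in `x`. -/
noncomputable def ademKernel (n : ℕ) : PowerSeries (ZMod p) :=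
  PowerSeries.mk fun i => coeff n (PowerSeries.X ^ i * ademSeries p i)

theorem coeff_one_sub_X_pow (N j : ℕ) :
    coeff j ((1 - PowerSeries.X : PowerSeries (ZMod p)) ^ N) = (-1) ^ j * (N.choose j : ZMod p) := by
  have h : (1 - PowerSeries.X : PowerSeries (ZMod p)) ^ N
      = rescale (-1) (((1 + Polynomial.X) ^ N : Polynomial (ZMod p)) : PowerSeries (ZMod p)) := by
    simp [sub_eq_add_neg, rescale_X]
  rw [h, coeff_rescale, Polynomial.coeff_coe, Polynomial.coeff_one_add_X_pow]

variable [Fact p.Prime]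

theorem one_sub_X_mul_ademSeries (i : ℕ) :
    (1 - PowerSeries.X) * ademSeries p i = (1 - PowerSeries.X) ^ ((p - 1) * i) := by
  have h2 := (Fact.out : p.Prime).two_le
  unfold ademSeries
  split_ifs with h
  · subst h
    simpa [mul_comm] using PowerSeries.mk_one_mul_one_sub_eq_one (ZMod p)
  · rw [← pow_succ']
    congr 1
    have : 0 < (p - 1) * i := Nat.mul_pos (by omega) (by omega)
    omega

theorem one_sub_X_mul_ademSeries_succ (i : ℕ) :
    (1 - PowerSeries.X) * ademSeries p (i + 1)
      = (1 - PowerSeries.X ^ p) * ademSeries p i := by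
  have h2 := (Fact.out : p.Prime).two_le
  have hne : (1 - PowerSeries.X : PowerSeries (ZMod p)) ≠ 0 := by
    intro h
    have := congrArg (coeff 0) h
    simp at this
  apply mul_left_cancel₀ hne
  rw [one_sub_X_mul_ademSeries, mul_left_comm, one_sub_X_mul_ademSeries]
  have : (1 - PowerSeries.X ^ p : PowerSeries (ZMod p)) = (1 - PowerSeries.X) ^ p := by
    have : CharP (PowerSeries (ZMod p)) p :=
      charP_of_injective_ringHom (PowerSeries.C_injective (R := ZMod p)) p
    rw [sub_pow_char, one_pow]
  rw [this, ← pow_succ', ← pow_add]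
  congr 1
  obtain ⟨q, rfl⟩ : ∃ q, p = q + 1 := ⟨p - 1, by omega⟩
  simp only [Nat.add_sub_cancel]
  ring

theorem ademKernel_zero : ademKernel p 0 = 1 := by
  ext i
  rcases i with _ | i
  · simp [ademKernel, ademSeries]
  · simp [ademKernel, pow_succ', coeff_one]

theorem ademKernel_succ (n : ℕ) :
    ademKernel p (n + 1) = (1 + PowerSeries.X) * ademKernel p n
      - if p ≤ n then PowerSeries.X * ademKernel p (n - p) else 0 := by
  ext i
  rcases i with _ | i
  · split_ifs <;> simp [ademKernel, ademSeries, add_mul]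
  · have key : coeff (n + 1) ((1 - PowerSeries.X) *
          (PowerSeries.X ^ (i + 1) * ademSeries p (i + 1)))
        = coeff (n + 1) (PowerSeries.X * ((1 - PowerSeries.X ^ p) *
          (PowerSeries.X ^ i * ademSeries p i))) := by
      congr 1
      calc _ = PowerSeries.X ^ (i + 1) * ((1 - PowerSeries.X) * ademSeries p (i + 1)) := by ring
        _ = _ := by rw [one_sub_X_mul_ademSeries_succ]; ring
    rw [coeff_succ_X_mul, sub_mul, sub_mul, one_mul, one_mul, map_sub, map_sub, coeff_succ_X_mul,
      coeff_X_pow_mul' (PowerSeries.X ^ i * ademSeries p i), sub_eq_iff_eq_add] at key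
    have e : ∀ m j : ℕ, coeff j (ademKernel p m) = coeff m (PowerSeries.X ^ j * ademSeries p j) :=
      fun m j => by simp [ademKernel]
    rw [e, key, add_mul, one_mul, map_sub, map_add, coeff_succ_X_mul, e, e]
    split_ifs
    · rw [coeff_succ_X_mul, e]; ring
    · simp; ring

/-- The binomial coefficient `((p+1)r - 1 choose r)` is divisible by `p`; the exponent relation
`α + n + 1 = (p + 1) K` is preserved by the recursion for `ademKernel`, which reduces everything to
this case. -/
theorem coeff_one_add_X_pow_mul_ademKernel (n : ℕ) : ∀ α K : ℕ, α + n + 1 = (p + 1) * K →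
    coeff K ((1 + PowerSeries.X) ^ α * ademKernel p n) = 0 := by
  induction n using Nat.strong_induction_on with
  | _ n ih =>
  intro α K h
  rcases n with _ | n
  · rw [ademKernel_zero, mul_one]
    have h' : ((1 + PowerSeries.X : PowerSeries (ZMod p)) ^ α)
        = (((1 + Polynomial.X) ^ α : Polynomial (ZMod p)) : PowerSeries (ZMod p)) := by simp
    rw [h', Polynomial.coeff_coe, Polynomial.coeff_one_add_X_pow, ZMod.natCast_eq_zero_iff]
    obtain ⟨r, rfl⟩ : ∃ r, K = r + 1 := ⟨K - 1, by
      rcases K with _ | K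
      · simp at h
      · simp⟩
    have h1 : α.choose (r + 1) * (r + 1) = α.choose r * (α - r) := Nat.choose_succ_right_eq α r
    have h2 : α - r = p * (r + 1) := by
      rw [Nat.sub_eq_iff_eq_add (by nlinarith)]
      linarith
    rw [h2, ← mul_assoc] at h1
    have h3 := Nat.eq_of_mul_eq_mul_right (Nat.succ_pos r) h1
    exact ⟨α.choose r, by rw [h3, mul_comm]⟩
  · rw [ademKernel_succ, mul_sub, map_sub, ← mul_assoc, ← pow_succ,
      ih n (by omega) (α + 1) K (by omega), zero_sub, neg_eq_zero]
    split_ifs with hpn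
    · rcases K with _ | K
      · simp at h
      · rw [mul_left_comm, coeff_succ_X_mul]
        refine ih _ (by omega) α K ?_
        rw [mul_add] at h
        omega
    · simp

/-- The binomial coefficient `(α choose t)` for `α ∈ ℕ` and `t ∈ ℤ`, zero for `t < 0`. -/
def chooseInt (α : ℕ) (t : ℤ) : ℕ := if 0 ≤ t then α.choose t.toNat else 0

theorem coeff_one_add_X_pow_mul_ademKernel_eq_sum (α n K : ℕ) :
    coeff K ((1 + PowerSeries.X) ^ α * ademKernel p n)
      = ∑ j ∈ range (n + 1), coeff j (ademSeries p (n - j)) *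
          (chooseInt α ((K : ℤ) - n + j) : ZMod p) := by
  have h' : ((1 + PowerSeries.X : PowerSeries (ZMod p)) ^ α)
      = (((1 + Polynomial.X) ^ α : Polynomial (ZMod p)) : PowerSeries (ZMod p)) := by simp
  rw [mul_comm, coeff_mul, Finset.Nat.sum_antidiagonal_eq_sum_range_succ
    (fun i l => coeff i (ademKernel p n) * coeff l ((1 + PowerSeries.X) ^ α))]
  rw [← Finset.sum_range_reflect _ (n + 1)]
  have e1 : ∀ i ∈ range (K + 1), coeff i (ademKernel p n) *
      coeff (K - i) ((1 + PowerSeries.X : PowerSeries (ZMod p)) ^ α)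
      = (fun i : ℕ => (if i ≤ n then coeff (n - i) (ademSeries p i) else 0) *
          (chooseInt α ((K : ℤ) - i) : ZMod p)) i := by
    intro i hi
    have hi : i ≤ K := by simpa [Nat.lt_succ_iff] using hi
    rw [h', Polynomial.coeff_coe, Polynomial.coeff_one_add_X_pow]
    have : ((K : ℤ) - i).toNat = K - i := by omega
    simp [ademKernel, coeff_X_pow_mul', chooseInt, hi, this]
  have e2 : ∀ j ∈ range (n + 1), coeff (n + 1 - 1 - j) (ademSeries p (n - (n + 1 - 1 - j))) *
      (chooseInt α ((K : ℤ) - n + ((n + 1 - 1 - j : ℕ) : ℤ)) : ZMod p)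
      = (fun i : ℕ => (if i ≤ n then coeff (n - i) (ademSeries p i) else 0) *
          (chooseInt α ((K : ℤ) - i) : ZMod p)) j := by
    intro j hj
    have hj : j ≤ n := by simpa [Nat.lt_succ_iff] using hj
    have a1 : n + 1 - 1 - j = n - j := by omega
    have a2 : n - (n - j) = j := by omega
    have a3 : (K : ℤ) - n + ((n - j : ℕ) : ℤ) = K - j := by omega
    simp only [a1, a2, a3, hj, if_true]
  rw [sum_congr rfl e1, sum_congr rfl e2]
  -- Both sums run over all `i ≤ min n K`: the remaining terms vanish.
  rw [sum_subset (range_subset_range.2 (show K + 1 ≤ n + K + 1 by omega)),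
    ← sum_subset (range_subset_range.2 (show n + 1 ≤ n + K + 1 by omega))]
  · intro i _ hi
    have : ¬ i ≤ n := by simpa [Nat.lt_succ_iff] using hi
    simp [this]
  · intro i _ hi
    have : ¬ (0 : ℤ) ≤ K - i := by
      have : K < i := by simpa [Nat.lt_succ_iff] using hi
      omega
    simp only [chooseInt, this, if_false, Nat.cast_zero, mul_zero]

theorem ademCoeff_eq_coeff {n j : ℕ} (h : j < n) :
    ademCoeff p n j = coeff j (ademSeries p (n - j)) := by
  have h2 := (Fact.out : p.Prime).two_le
  have h0 : 0 < (p - 1) * (n - j) := Nat.mul_pos (by omega) (by omega)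
  have e : ((p : ℤ) - 1) * ((n : ℤ) - j) - 1 = (((p - 1) * (n - j) - 1 : ℕ) : ℤ) := by
    push_cast [Nat.cast_sub (show 1 ≤ (p - 1) * (n - j) from h0),
      Nat.cast_sub (show 1 ≤ p by omega), Nat.cast_sub h.le]
    ring
  rw [ademSeries, if_neg (by omega), coeff_one_sub_X_pow, ademCoeff, e, ibinom,
    if_pos (Int.natCast_nonneg _), Int.toNat_natCast]

theorem ademCoeff_self (n : ℕ) : ademCoeff p n n = 0 := by
  simp [ademCoeff, ibinom]

/-- The Adem relation for binomial coefficients. The summand `α choose K` is the term `j = n` that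
`ademCoeff` leaves out. -/
theorem sum_ademCoeff_mul_choose (α n : ℕ) (K : ℤ) (h : (α : ℤ) + n + 1 = (p + 1) * K) :
    (chooseInt α K : ZMod p) +
      ∑ j ∈ range (n + 1), ademCoeff p n j * (chooseInt α (K - n + j) : ZMod p) = 0 := by
  obtain ⟨K, rfl⟩ : ∃ k : ℕ, K = k := Int.eq_ofNat_of_zero_le (by
    by_contra hK
    have : ((p : ℤ) + 1) * K < 0 := mul_neg_of_pos_of_neg (by positivity) (by omega)
    omega)
  rw [← coeff_one_add_X_pow_mul_ademKernel p n α K (by exact_mod_cast h),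
    coeff_one_add_X_pow_mul_ademKernel_eq_sum, sum_range_succ, sum_range_succ, ademCoeff_self,
    sum_congr rfl fun j hj => by rw [ademCoeff_eq_coeff p (mem_range.1 hj)]]
  simp [ademSeries, add_comm]

end Binomial

/-! ### Steenrod operations on a polynomial ring -/

section Operations

open Polynomial

section

variable {A : Type*} [CommRing A]

/-- The coefficient of `v ^ a u ^ b` in a polynomial in the outer variable `v` and the inner
variable `u`, zero for negative exponents. -/
noncomputable def coeffPair (a b : ℤ) : A[X][X] →ₗ[A] A :=
  if 0 ≤ a ∧ 0 ≤ b then lcoeff A b.toNat ∘ₗ (lcoeff A[X] a.toNat).restrictScalars A else 0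

theorem coeffPair_pow_mul_pow (p α β : ℕ) (hp : 0 < p) (a b : ℤ) :
    coeffPair a b ((X + C X) ^ α * (C X * X ^ p) ^ β : A[X][X])
      = if a + b = α + (p + 1) * β then (chooseInt α (b - β) : A) else 0 := by
  have h1 : ((X + C X) ^ α * (C X * X ^ p) ^ β : A[X][X])
      = (X + C X) ^ α * C (X ^ β) * X ^ (p * β) := by
    rw [mul_pow, C_pow, ← pow_mul, mul_assoc]
  unfold coeffPair
  by_cases h0 : 0 ≤ a ∧ 0 ≤ b
  · obtain ⟨⟨a, rfl⟩, ⟨b, rfl⟩⟩ := And.imp Int.eq_ofNat_of_zero_le Int.eq_ofNat_of_zero_le h0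
    rw [if_pos h0, h1]
    simp only [LinearMap.comp_apply, LinearMap.restrictScalars_apply, lcoeff_apply,
      Int.toNat_natCast, coeff_mul_X_pow', coeff_mul_C]
    by_cases h2 : p * β ≤ a
    · obtain ⟨a, rfl⟩ := Nat.exists_eq_add_of_le h2
      rw [if_pos h2, Nat.add_sub_cancel_left, coeff_X_add_C_pow, mul_right_comm, ← pow_add,
        ← C_eq_natCast, coeff_mul_C, coeff_X_pow]
      by_cases h3 : a ≤ α
      · obtain ⟨t, rfl⟩ := Nat.exists_eq_add_of_le h3
        rw [Nat.add_sub_cancel_left]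
        by_cases h4 : b = t + β
        · subst h4
          have e : (chooseInt (a + t) (((t + β : ℕ) : ℤ) - β)) = (a + t).choose a := by
            rw [chooseInt, if_pos (by omega), show (((t + β : ℕ) : ℤ) - β).toNat = t by omega,
              Nat.choose_symm_add]
          rw [if_pos rfl, if_pos (by push_cast; ring), e, one_mul]
        · rw [if_neg h4, if_neg, zero_mul]
          intro h
          apply h4
          zify
          push_cast at h
          linarith
      · rw [Nat.choose_eq_zero_of_lt (by omega)]
        rw [Nat.cast_zero, mul_zero]
        split_ifs with h
        · rw [chooseInt, if_neg]
          · simp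
          · push_cast at h
            have : (p : ℤ) * β + a + b = α + p * β + β := by linarith
            omega
        · rfl
    · rw [if_neg h2, coeff_zero]
      split_ifs with h
      · rw [chooseInt]
        split_ifs
        · rw [Nat.choose_eq_zero_of_lt]
          · simp
          · zify at h2
            have : (a : ℤ) + b = α + p * β + β := by linarith
            omega
        · simp
      · rfl
  · rw [if_neg h0, LinearMap.zero_apply]
    split_ifs with h
    · have h' : a + b = α + p * β + β := by linarith
      have h2 : (0 : ℤ) ≤ p * β := by positivity
      rw [chooseInt]
      split_ifs
      · rw [Nat.choose_eq_zero_of_lt]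
        · simp
        · omega
      · simp
    · rfl

variable (p : ℕ) [Fact p.Prime]

theorem coeffPair_adem [Algebra (ZMod p) A] (k : ℤ) (n : ℕ) (y : A[X][X])
    (hy : y ∈ (MvPolynomial.aeval (R := A) ![(X + C X : A[X][X]), C X * X ^ p]).range) :
    coeffPair (p * k - 1 - n) k y +
      ∑ j ∈ Finset.range (n + 1), ademCoeff p n j •
        coeffPair (p * k - 1 - j) (k - n + j) y = 0 := by
  obtain ⟨f, rfl⟩ := hy
  induction f using MvPolynomial.induction_on' with
  | monomial d a =>
    have e : MvPolynomial.aeval (R := A) ![(X + C X : A[X][X]), C X * X ^ p]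
        (MvPolynomial.monomial d a)
        = a • ((X + C X) ^ d 0 * (C X * X ^ p) ^ d 1) := by
      rw [MvPolynomial.aeval_monomial, Finsupp.prod_fintype _ _ (by simp), Fin.prod_univ_two,
        Algebra.smul_def]
      rfl
    simp only [AlgHom.toRingHom_eq_coe, RingHom.coe_coe]
    rw [e]
    simp only [map_smul, coeffPair_pow_mul_pow p _ _ (Fact.out : p.Prime).pos]
    simp only [smul_comm _ a, ← Finset.smul_sum, ← smul_add]
    have e2 : ∀ j : ℕ, p * k - 1 - (j : ℤ) + (k - n + j) = p * k - 1 - n + k := fun j => by ring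
    simp only [e2]
    split_ifs with h
    · have := congrArg (algebraMap (ZMod p) A)
        (sum_ademCoeff_mul_choose p (d 0) n (k - d 1) (by linarith))
      simp only [map_add, map_sum, map_mul, map_natCast, map_zero, ← Algebra.smul_def] at this
      have e3 : ∀ j : ℕ, k - (n : ℤ) + j - d 1 = k - d 1 - n + j := fun j => by ring
      simp only [e3]
      rw [this, smul_zero]
    · simp
  | add f g hf hg =>
    simp only [map_add, smul_add, Finset.sum_add_distrib]
    rw [add_add_add_comm]
    simp only [RingHom.coe_coe, AlgHom.toRingHom_eq_coe] at hf hg ⊢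
    rw [hf, hg, add_zero]

/-- The additivity of `p`-powers behind the shape of the iterated total operation. -/
theorem doubleOp_aux [CharP A p] (a b c : A) (r : ℕ) :
    (C (C a + C b * X ^ p ^ (r + 1)) + C (C b + C c * X ^ p ^ r) * X ^ p ^ (r + 1) : A[X][X])
      = C (C a) + C (C b) * (X + C X) ^ p ^ (r + 1) + C (C c) * (C X * X ^ p) ^ p ^ r := by
  rw [add_pow_char_pow]
  simp only [map_add, map_mul, map_pow]
  ring

end

variable (p : ℕ)

/-- The polynomial ring `𝔽_p[w₁, w₂, …]`; the variable `X r` stands for `w_{r+1}`. -/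
abbrev Coeffs (p : ℕ) : Type := MvPolynomial ℕ (ZMod p)

/-- The element `w_r`, with `w_0 = 1`. -/
noncomputable def wgen : ℕ → Coeffs p
  | 0 => 1
  | r + 1 => MvPolynomial.X r

/-- The total operation, `w_{r+1} ↦ w_{r+1} + w_r v ^ (p ^ r)`. If `∑ w_r F ^ r` is a generic
polynomial in the Frobenius `F`, this is its composition with `1 + v F` on the right. -/
noncomputable def totalOp : Coeffs p →ₐ[ZMod p] (Coeffs p)[X] :=
  MvPolynomial.aeval fun r => C (wgen p (r + 1)) + C (wgen p r) * X ^ p ^ r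

theorem totalOp_wgen_zero : totalOp p (wgen p 0) = 1 := map_one _

theorem totalOp_wgen_succ (r : ℕ) :
    totalOp p (wgen p (r + 1)) = C (wgen p (r + 1)) + C (wgen p r) * X ^ p ^ r := by
  rw [totalOp, wgen, MvPolynomial.aeval_X, wgen]

/-- The operation `P_k`: the coefficient of `v ^ k` in the total operation, zero for `k < 0`. -/
noncomputable def steenrodOp (k : ℤ) : Coeffs p →ₗ[ZMod p] Coeffs p :=
  if 0 ≤ k then ((lcoeff (Coeffs p) k.toNat).restrictScalars (ZMod p)) ∘ₗ (totalOp p).toLinearMap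
  else 0

theorem steenrodOp_natCast (k : ℕ) (x : Coeffs p) :
    steenrodOp p k x = (totalOp p x).coeff k := by
  simp [steenrodOp]

theorem steenrodOp_of_neg {k : ℤ} (hk : k < 0) : steenrodOp p k = 0 := by
  simp [steenrodOp, not_le.2 hk]

/-- The iterated total operation. -/
noncomputable def doubleOp : Coeffs p →+* (Coeffs p)[X][X] :=
  (mapRingHom (totalOp p : Coeffs p →+* (Coeffs p)[X])).comp (totalOp p : Coeffs p →+* (Coeffs p)[X])

theorem steenrodOp_steenrodOp (a b : ℤ) (x : Coeffs p) :
    steenrodOp p b (steenrodOp p a x) = coeffPair a b (doubleOp p x) := by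
  unfold coeffPair
  split_ifs with h
  · obtain ⟨⟨a, rfl⟩, ⟨b, rfl⟩⟩ := And.imp Int.eq_ofNat_of_zero_le Int.eq_ofNat_of_zero_le h
    simp [steenrodOp_natCast, doubleOp]
  · rw [not_and_or, not_le, not_le] at h
    rcases h with h | h <;> simp [steenrodOp_of_neg p h]

variable [Fact p.Prime]

/-- The iterated total operation only involves `u + v` and `u v ^ p`. -/
theorem doubleOp_mem_range (x : Coeffs p) : doubleOp p x ∈
    (MvPolynomial.aeval (R := Coeffs p)
      ![(X + C X : (Coeffs p)[X][X]), C X * X ^ p]).range := by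
  set B := (MvPolynomial.aeval (R := Coeffs p)
      ![(X + C X : (Coeffs p)[X][X]), C X * X ^ p]).range
  have hs : (X + C X : (Coeffs p)[X][X]) ∈ B := ⟨MvPolynomial.X 0, by simp⟩
  have hq : (C X * X ^ p : (Coeffs p)[X][X]) ∈ B := ⟨MvPolynomial.X 1, by simp⟩
  have hc : ∀ a : Coeffs p, (C (C a) : (Coeffs p)[X][X]) ∈ B := fun a => B.algebraMap_mem a
  induction x using MvPolynomial.induction_on with
  | C a =>
    have : doubleOp p (MvPolynomial.C a) = C (C (MvPolynomial.C a)) := by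
      have h : totalOp p (MvPolynomial.C a) = C (MvPolynomial.C a) := (totalOp p).commutes a
      simp [doubleOp, h]
    rw [this]; exact hc _
  | add x y hx hy => rw [map_add]; exact add_mem hx hy
  | mul_X x r hx =>
    rw [map_mul]
    refine mul_mem hx ?_
    have h1 : doubleOp p (MvPolynomial.X r) = C (totalOp p (wgen p (r + 1)))
        + C (totalOp p (wgen p r)) * X ^ p ^ r := by
      have := totalOp_wgen_succ p r
      rw [wgen] at this
      simp [doubleOp, this, wgen]
    rw [h1, totalOp_wgen_succ]
    rcases r with _ | r
    · rw [totalOp_wgen_zero]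
      have : (C (C (wgen p (0 + 1)) + C (wgen p 0) * X ^ p ^ 0) + C 1 * X ^ p ^ 0 :
          (Coeffs p)[X][X]) = C (C (wgen p (0 + 1))) + (X + C X) := by
        simp [wgen]; ring
      rw [this]
      exact add_mem (hc _) hs
    · rw [totalOp_wgen_succ]
      rw [doubleOp_aux]
      exact add_mem (add_mem (hc _) (mul_mem (hc _) (pow_mem hs _)))
        (mul_mem (hc _) (pow_mem hq _))

/-- The Adem relation `R(ε,k,n)` for the operations `P_k`, acting from the right: in a product the
left factor acts first. -/
theorem steenrodOp_adem (k : ℤ) (n : ℕ) (x : Coeffs p) :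
    steenrodOp p k (steenrodOp p (p * k - 1 - n) x) +
      ∑ j ∈ Finset.range (n + 1), ademCoeff p n j •
        steenrodOp p (k - n + j) (steenrodOp p (p * k - 1 - j) x) = 0 := by
  simp only [steenrodOp_steenrodOp]
  exact coeffPair_adem p k n _ (doubleOp_mem_range p x)

end Operations

/-! ### Maps out of the universal Steenrod algebra -/

/-- The coefficient of the `j`-th term of the last sum in `S(ε,k,n)`. -/
noncomputable def ademCoeffBockstein (p n j : ℕ) : ZMod p :=
  (-1) ^ (j + 1) * (ibinom (((p : ℤ) - 1) * ((n : ℤ) - j)) j : ZMod p)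

section Lift

variable (p : ℕ) {B : Type*} [Semiring B] [Algebra (ZMod p) B]

/-- The relation `R(ε,k,n)` for a family of elements of an algebra. -/
def SatisfiesR (g : Fin 2 → ℤ → B) : Prop := ∀ (ε : Fin 2) (k : ℤ) (n : ℕ),
  g ε (p * k - 1 - n) * g 0 k + ∑ j ∈ Finset.range (n + 1), ademCoeff p n j •
    (g ε (p * k - 1 - j) * g 0 (k - n + j)) = 0

/-- The relation `S(ε,k,n)` for a family of elements of an algebra. -/
def SatisfiesS (g : Fin 2 → ℤ → B) : Prop := ∀ (ε : Fin 2) (k : ℤ) (n : ℕ),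
  g ε (p * k - n) * g 1 k + ∑ j ∈ Finset.range (n + 1), ademCoeff p n j •
      (g ε (p * k - j) * g 1 (k - n + j)) +
    (if ε = 0 then ∑ j ∈ Finset.range (n + 1), ademCoeffBockstein p n j •
      (g 1 (p * k - j) * g 0 (k - n + j)) else 0) = 0

theorem z_satisfiesR : SatisfiesR p (z p) := by
  intro ε k n
  have := RingQuot.mkAlgHom_rel (ZMod p) (AdemRel.ofR (p := p) ε k n)
  rw [relR, map_zero] at this
  simp only [map_add, map_mul, map_sum, map_smul] at this
  exact this

/-- The algebra homomorphism `𝒬(p) → B` determined by the images of the generators. -/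
noncomputable def liftQ (g : Fin 2 → ℤ → B) (hR : SatisfiesR p g) (hS : SatisfiesS p g) :
    Q p →ₐ[ZMod p] B :=
  RingQuot.liftAlgHom (ZMod p) ⟨FreeAlgebra.lift (ZMod p) fun x => g x.1 x.2, by
    have hz : ∀ ε k, FreeAlgebra.lift (ZMod p) (fun x : Fin 2 × ℤ => g x.1 x.2) (fz p ε k)
        = g ε k := fun ε k => by rw [fz, FreeAlgebra.lift_ι_apply]
    intro x y h
    cases h with
    | ofR ε k n =>
      simp only [relR, map_add, map_mul, map_sum, map_smul, hz, map_zero]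
      exact hR ε k n
    | ofS ε k n =>
      rw [relS, map_zero, ← hS ε k n]
      split_ifs <;> simp only [map_add, map_mul, map_sum, map_smul, hz, map_zero] <;> rfl⟩

theorem liftQ_z (g : Fin 2 → ℤ → B) (hR : SatisfiesR p g) (hS : SatisfiesS p g) (ε : Fin 2)
    (k : ℤ) : liftQ p g hR hS (z p ε k) = g ε k := by
  rw [liftQ, z, RingQuot.liftAlgHom_mkAlgHom_apply, fz, FreeAlgebra.lift_ι_apply]

/-- The family with `z_{0,k} ↦ f k` and `z_{1,k} ↦ 0`. -/
def evenFamily (f : ℤ → B) : Fin 2 → ℤ → B := fun ε k => if ε = 0 then f k else 0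

theorem evenFamily_satisfiesR (f : ℤ → B) (hf : ∀ (k : ℤ) (n : ℕ),
    f (p * k - 1 - n) * f k + ∑ j ∈ Finset.range (n + 1), ademCoeff p n j •
      (f (p * k - 1 - j) * f (k - n + j)) = 0) : SatisfiesR p (evenFamily f) := by
  intro ε k n
  by_cases h : ε = 0
  · simpa [evenFamily, h] using hf k n
  · simp [evenFamily, h]

theorem evenFamily_satisfiesS (f : ℤ → B) : SatisfiesS p (evenFamily f) := by
  intro ε k n
  simp [evenFamily]

/-- The product `z_{0,i₁} ⋯ z_{0,i_m}`. -/
noncomputable def word (l : List ℤ) : Q p := (l.map (z p 0)).prod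

@[simp] theorem word_nil : word p [] = 1 := rfl

@[simp] theorem word_cons (i : ℤ) (l : List ℤ) : word p (i :: l) = z p 0 i * word p l := by
  simp [word]

@[simp] theorem word_append (l l' : List ℤ) : word p (l ++ l') = word p l * word p l' := by
  simp [word]

end Lift

/-- A word is admissible if its letters satisfy `i_l ≥ p i_{l+1}`. -/
def Admissible (p : ℕ) (l : List ℤ) : Prop := l.IsChain fun a b => (p : ℤ) * b ≤ a

/-! ### Linear independence of the admissible words -/

section Independence

variable (p : ℕ) (c : ℕ)

/-- The operator `(f_r) ↦ (P_{k + p^r c} f_{r+1})` on sequences in `𝔽_p[w₁, w₂, …]`. The Adem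
relations are invariant under adding `p C` and `C` to the two indices of every monomial, so these
shifted operations satisfy them too; the sequence index counts the letters still to come. -/
noncomputable def shiftOp (k : ℤ) : Module.End (ZMod p) (ℕ → Coeffs p) :=
  LinearMap.pi fun r => steenrodOp p (k + p ^ r * c) ∘ₗ LinearMap.proj (r + 1)

theorem shiftOp_apply (k : ℤ) (f : ℕ → Coeffs p) (r : ℕ) :
    shiftOp p c k f r = steenrodOp p (k + p ^ r * c) (f (r + 1)) := rfl

/-- The iterated operation by which a word acts on the sequence entry at its length. -/
noncomputable def wordOp : List ℤ → Coeffs p →ₗ[ZMod p] Coeffs p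
  | [] => LinearMap.id
  | i :: l => wordOp l ∘ₗ steenrodOp p (i + p ^ l.length * c)

/-- For admissible `I = (i₁, …, i_m)`, the monomial `∏ w_{q+l} ^ (i_{l+1} - p i_{l+2})`, where the
last exponent is `i_m + c`. -/
noncomputable def testMonomial : ℕ → List ℤ → Coeffs p
  | _, [] => 1
  | q, [i] => wgen p q ^ (i + c).toNat
  | q, i :: j :: t => wgen p q ^ (i - p * j).toNat * testMonomial (q + 1) (j :: t)

theorem testMonomial_zero_cons (i : ℤ) (t : List ℤ) :
    testMonomial p c 0 (i :: t) = testMonomial p c 1 t := by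
  rcases t with _ | ⟨j, t⟩ <;> simp [testMonomial, wgen]

variable [Fact p.Prime]

/-- The right action of `𝒬(p)` on sequences in which `z_{0,k}` is `shiftOp` and `z_{1,k}` is `0`. -/
noncomputable def shiftRep : Q p →ₐ[ZMod p] (Module.End (ZMod p) (ℕ → Coeffs p))ᵐᵒᵖ :=
  liftQ p (evenFamily fun k => op (shiftOp p c k))
    (evenFamily_satisfiesR p _ fun k n => by
      apply unop_injective
      refine LinearMap.ext fun f => funext fun r => ?_
      have h := steenrodOp_adem p (k + p ^ r * c) n (f (r + 2))
      have e1 : ∀ j : ℕ, (p : ℤ) * (k + p ^ r * c) - 1 - j = p * k - 1 - j + p ^ (r + 1) * c :=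
        fun j => by ring
      have e2 : ∀ j : ℕ, k + (p : ℤ) ^ r * c - n + j = k - n + j + p ^ r * c := fun j => by ring
      simp only [e1, e2] at h
      simpa [Finset.unop_sum, shiftOp_apply] using h)
    (evenFamily_satisfiesS p _)

theorem shiftRep_word_single (l : List ℤ) : ∀ (m : ℕ) (x : Coeffs p),
    (shiftRep p c (word p l)).unop (Pi.single m x) 0
      = if l.length = m then wordOp p c l x else 0 := by
  have hz : ∀ i, (shiftRep p c (z p 0 i)).unop = shiftOp p c i := fun i => by
    rw [shiftRep, liftQ_z]; rfl
  induction l with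
  | nil =>
    intro m x
    rcases m with _ | m <;> simp [wordOp]
  | cons i l ih =>
    intro m x
    rw [word_cons, map_mul, unop_mul, Module.End.mul_apply, hz]
    rcases m with _ | m
    · have : shiftOp p c i (Pi.single 0 x) = 0 := by
        funext r
        simp [shiftOp_apply]
      simp [this]
    · have : shiftOp p c i (Pi.single (m + 1) x)
          = Pi.single m (steenrodOp p (i + p ^ m * c) x) := by
        funext r
        rw [shiftOp_apply]
        rcases eq_or_ne r m with rfl | h
        · simp
        · simp [h]
      rw [this, ih]
      simp only [List.length_cons, Nat.add_right_cancel_iff]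
      split_ifs with h
      · subst h; rfl
      · rfl

open Polynomial in
theorem totalOp_wgen_succ_pow (q e : ℕ) :
    (totalOp p (wgen p (q + 1) ^ e)).natDegree ≤ e * p ^ q ∧
      (totalOp p (wgen p (q + 1) ^ e)).coeff (e * p ^ q) = wgen p q ^ e := by
  have h0 : p ^ q ≠ 0 := pow_ne_zero _ (Fact.out : p.Prime).ne_zero
  have h1 : (totalOp p (wgen p (q + 1))).natDegree ≤ p ^ q := by
    rw [totalOp_wgen_succ]
    compute_degree
  have h2 : (totalOp p (wgen p (q + 1))).coeff (p ^ q) = wgen p q := by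
    rw [totalOp_wgen_succ]
    simp [coeff_C, (Fact.out : p.Prime).ne_zero]
  rw [map_pow]
  exact ⟨natDegree_pow_le_of_le e h1, by rw [coeff_pow_of_natDegree_le h1, h2]⟩

/-- The leading coefficient of the total operation on a test monomial. -/
theorem totalOp_testMonomial (t : List ℤ) : ∀ (i : ℤ) (q : ℕ),
    Admissible p (i :: t) → (∀ a ∈ i :: t, 0 ≤ a + c) →
    ∃ D : ℕ, (D : ℤ) = p ^ q * (i + p ^ t.length * c) ∧
      (totalOp p (testMonomial p c (q + 1) (i :: t))).natDegree ≤ D ∧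
      (totalOp p (testMonomial p c (q + 1) (i :: t))).coeff D = testMonomial p c q (i :: t) := by
  induction t with
  | nil =>
    intro i q _ hc
    have hi : 0 ≤ i + c := hc i (by simp)
    obtain ⟨h1, h2⟩ := totalOp_wgen_succ_pow p q (i + c).toNat
    refine ⟨(i + c).toNat * p ^ q, ?_, h1, h2⟩
    push_cast [Int.toNat_of_nonneg hi]
    simp [mul_comm]
  | cons j t ih =>
    intro i q ha hc
    rw [Admissible, List.isChain_cons_cons] at ha
    obtain ⟨D, hD, h3, h4⟩ := ih j (q + 1) ha.2 fun a h => hc a (List.mem_cons_of_mem _ h)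
    obtain ⟨h1, h2⟩ := totalOp_wgen_succ_pow p q (i - p * j).toNat
    refine ⟨(i - p * j).toNat * p ^ q + D, ?_, ?_, ?_⟩
    · push_cast [Int.toNat_of_nonneg (sub_nonneg.2 ha.1), hD, List.length_cons]
      ring
    · rw [testMonomial, map_mul]
      exact Polynomial.natDegree_mul_le_of_le h1 h3
    · rw [testMonomial, map_mul, Polynomial.coeff_mul_add_eq_of_natDegree_le h1 h3, h2, h4, testMonomial]

theorem wordOp_testMonomial_self (I : List ℤ) (hI : Admissible p I)
    (hc : ∀ a ∈ I, 0 ≤ a + c) : wordOp p c I (testMonomial p c 1 I) = 1 := by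
  induction I with
  | nil => rfl
  | cons i t ih =>
    obtain ⟨D, hD, -, h2⟩ := totalOp_testMonomial p c t i 0 hI hc
    rw [wordOp, LinearMap.comp_apply, ← one_mul (i + _), ← pow_zero (p : ℤ), ← hD,
      steenrodOp_natCast, h2, testMonomial_zero_cons]
    exact ih hI.tail fun a h => hc a (List.mem_cons_of_mem _ h)

theorem wordOp_testMonomial_of_lt (I : List ℤ) : ∀ J : List ℤ,
    Admissible p I → (∀ a ∈ I, 0 ≤ a + c) → J.length = I.length → I < J →
    wordOp p c J (testMonomial p c 1 I) = 0 := by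
  induction I with
  | nil =>
    intro J _ _ hl hlt
    rw [List.length_nil, List.length_eq_zero_iff] at hl
    subst hl
    exact absurd hlt (lt_irrefl _)
  | cons i t ih =>
    intro J hI hc hl hlt
    rcases J with _ | ⟨j, u⟩
    · simp at hl
    · simp only [List.length_cons, Nat.add_right_cancel_iff] at hl
      obtain ⟨D, hD, h1, h2⟩ := totalOp_testMonomial p c t i 0 hI hc
      rw [pow_zero, one_mul] at hD
      rw [wordOp, LinearMap.comp_apply, hl]
      rcases List.cons_lt_cons_iff.1 hlt with h | ⟨rfl, h⟩
      · obtain ⟨E, hE⟩ : ∃ E : ℕ, j + (p : ℤ) ^ t.length * c = E :=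
          Int.eq_ofNat_of_zero_le (by omega)
        rw [hE, steenrodOp_natCast, Polynomial.coeff_eq_zero_of_natDegree_lt (h1.trans_lt (by omega)),
          map_zero]
      · rw [← hD, steenrodOp_natCast, h2, testMonomial_zero_cons]
        exact ih u hI.tail (fun a h => hc a (List.mem_cons_of_mem _ h)) hl h

/-- The lexicographically smallest word `I` of a vanishing combination has coefficient `0`: the test
monomial of `I` is sent to `1` by `I`, and to `0` by every larger admissible word. -/
theorem linearIndependent_word : LinearIndependent (ZMod p)
    (fun l : {l : List ℤ // Admissible p l} => word p l) := by
  rw [linearIndependent_iff]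
  intro f hf
  by_contra hne
  have hs : f.support.Nonempty := Finsupp.support_nonempty_iff.2 hne
  set I := f.support.min' hs
  have hI : I ∈ f.support := Finset.min'_mem _ _
  -- A shift that makes all letters of `I` nonnegative.
  set c : ℕ := (I.1.map Int.natAbs).sum
  have hc : ∀ a ∈ I.1, 0 ≤ a + (c : ℤ) := by
    intro a ha
    have : a.natAbs ≤ c := List.le_sum_of_mem (List.mem_map_of_mem ha)
    omega
  have h := congrArg (fun x => (shiftRep p c x).unop
    (Pi.single I.1.length (testMonomial p c 1 I.1)) 0) hf
  simp only [Finsupp.linearCombination_apply, Finsupp.sum, map_sum, map_smul, Finset.unop_sum,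
    unop_smul, LinearMap.sum_apply, LinearMap.smul_apply, Finset.sum_apply, Pi.smul_apply,
    shiftRep_word_single, map_zero, unop_zero, LinearMap.zero_apply, Pi.zero_apply] at h
  rw [Finset.sum_eq_single_of_mem I hI, if_pos rfl, wordOp_testMonomial_self p c _ I.2 hc,
    ← MvPolynomial.C_1, MvPolynomial.smul_eq_C_mul, ← MvPolynomial.C_mul, mul_one,
    MvPolynomial.C_eq_zero] at h
  · exact Finsupp.mem_support_iff.1 hI h
  · intro J hJ hJI
    have hlt : I < J := lt_of_le_of_ne (Finset.min'_le _ _ hJ) (Ne.symm hJI)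
    split_ifs with hl
    · rw [wordOp_testMonomial_of_lt p c I.1 J.1 I.2 hc hl hlt, smul_zero]
    · rw [smul_zero]

end Independence

/-! ### Admissible words span -/

section Span

variable (p K : ℕ)

/-- The `l`-th letter from the right, counted from `0`, is at most `p ^ l K`. Applying an Adem
relation to an inadmissible pair preserves this bound. -/
def LettersBounded : List ℤ → Prop
  | [] => True
  | i :: t => i ≤ p ^ t.length * K ∧ LettersBounded t

/-- A nonnegative integer attached to a word with bounded letters, which drops when an Adem relation
moves weight from a letter to its left neighbour. -/
def defect : List ℤ → ℤ
  | [] => 0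
  | i :: t => t.length * (p ^ t.length * K - i) + defect t

variable {p K}

theorem defect_nonneg {l : List ℤ} (h : LettersBounded p K l) : 0 ≤ defect p K l := by
  induction l with
  | nil => exact le_refl _
  | cons i t ih =>
    exact add_nonneg (mul_nonneg (by positivity) (sub_nonneg.2 h.1)) (ih h.2)

theorem LettersBounded.replace {l l₁ : List ℤ} {a b a' b' : ℤ} (h1 : b' ≤ b)
    (h2 : a' ≤ p * b) (h : LettersBounded p K (l₁ ++ a :: b :: l)) :
    LettersBounded p K (l₁ ++ a' :: b' :: l) := by
  induction l₁ with
  | nil =>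
    simp only [List.nil_append, LettersBounded, List.length_cons] at h ⊢
    refine ⟨h2.trans ?_, h1.trans h.2.1, h.2.2⟩
    rw [pow_succ', mul_assoc]
    exact mul_le_mul_of_nonneg_left h.2.1 (by positivity)
  | cons i t ih =>
    simp only [List.cons_append, LettersBounded] at h ⊢
    exact ⟨by simpa using h.1, ih h.2⟩

theorem defect_replace (l l₁ : List ℤ) {a b a' b' : ℤ} (h : a' + b' = a + b) :
    defect p K (l₁ ++ a' :: b' :: l) = defect p K (l₁ ++ a :: b :: l) - (a' - a) := by
  induction l₁ with
  | nil =>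
    obtain rfl : b' = a + b - a' := by linarith
    simp only [List.nil_append, defect, List.length_cons]
    push_cast
    ring
  | cons i t ih =>
    simp only [List.cons_append, defect, List.length_append, List.length_cons] at ih ⊢
    rw [ih]
    ring

theorem exists_lettersBounded (hp : 0 < p) (l : List ℤ) : ∃ K : ℕ, LettersBounded p K l := by
  have mono : ∀ {K K' : ℕ} (l : List ℤ), K ≤ K' → LettersBounded p K l → LettersBounded p K' l := by
    intro K K' l hK h
    induction l with
    | nil => trivial
    | cons i t ih =>
      exact ⟨h.1.trans (mul_le_mul_of_nonneg_left (by exact_mod_cast hK) (by positivity)), ih h.2⟩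
  induction l with
  | nil => exact ⟨0, trivial⟩
  | cons i t ih =>
    obtain ⟨K, hK⟩ := ih
    refine ⟨max K i.toNat, ?_, mono t (le_max_left _ _) hK⟩
    have h1 : i ≤ (max K i.toNat : ℕ) := by omega
    have h2 : (1 : ℤ) ≤ p ^ t.length := by exact_mod_cast Nat.one_le_pow _ _ hp
    exact h1.trans (le_mul_of_one_le_left (by positivity) h2)

variable (p)

/-- The span of the admissible words. -/
noncomputable def admissibleSpan : Submodule (ZMod p) (Q p) :=
  Submodule.span (ZMod p) (Set.range fun l : {l : List ℤ // Admissible p l} => word p l)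

/-- Solving a relation for its leading term inside a product. -/
theorem mul_mul_eq_sum_of_add_eq_zero {B ι : Type*} [Ring B] [Algebra (ZMod p) B] {x u v : B}
    {s : Finset ι} {a : ι → ZMod p} {y : ι → B} (h : x + ∑ j ∈ s, a j • y j = 0) :
    u * x * v = ∑ j ∈ s, (-a j) • (u * y j * v) := by
  rw [eq_neg_of_add_eq_zero_left h, mul_neg, neg_mul, Finset.mul_sum, Finset.sum_mul,
    ← Finset.sum_neg_distrib]
  exact Finset.sum_congr rfl fun j _ => by rw [mul_smul_comm, smul_mul_assoc, neg_smul]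

variable [Fact p.Prime]

theorem word_mem_admissibleSpan_of_bounded (K N : ℕ) : ∀ l : List ℤ, LettersBounded p K l →
    (defect p K l).toNat = N → word p l ∈ admissibleSpan p := by
  induction N using Nat.strong_induction_on with
  | _ N ih =>
  intro l hl hN
  by_cases ha : Admissible p l
  · exact Submodule.subset_span ⟨⟨l, ha⟩, rfl⟩
  · rw [Admissible, List.isChain_iff_forall_rel_of_append_cons_cons] at ha
    push Not at ha
    obtain ⟨a, b, l₁, l₂, rfl, hab⟩ := ha
    obtain ⟨n, hn⟩ : ∃ n : ℕ, p * b - 1 - a = n := Int.eq_ofNat_of_zero_le (by omega)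
    have hR := z_satisfiesR p 0 b n
    rw [show (p : ℤ) * b - 1 - n = a by omega] at hR
    have hw : word p (l₁ ++ a :: b :: l₂) = word p l₁ * (z p 0 a * z p 0 b) * word p l₂ := by
      simp [mul_assoc]
    rw [hw, mul_mul_eq_sum_of_add_eq_zero p hR]
    refine sum_mem fun j hj => ?_
    rcases (Nat.lt_succ_iff.1 (Finset.mem_range.1 hj)).lt_or_eq with hj | rfl
    · refine Submodule.smul_mem _ _ ?_
      have hw' : word p l₁ * (z p 0 (p * b - 1 - j) * z p 0 (b - n + j)) * word p l₂
          = word p (l₁ ++ (p * b - 1 - j) :: (b - n + j) :: l₂) := by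
        simp [mul_assoc]
      rw [hw']
      have hl' : LettersBounded p K (l₁ ++ (p * b - 1 - j) :: (b - n + j) :: l₂) :=
        hl.replace (by omega) (by omega)
      refine ih _ ?_ _ hl' rfl
      have h1 := defect_replace (p := p) (K := K) l₂ l₁
        (show (p * b - 1 - j : ℤ) + (b - n + j) = a + b by omega)
      have h2 := defect_nonneg hl'
      omega
    · rw [ademCoeff_self, neg_zero, zero_smul]
      exact zero_mem _

theorem word_mem_admissibleSpan (l : List ℤ) : word p l ∈ admissibleSpan p := by
  obtain ⟨K, hK⟩ := exists_lettersBounded (Fact.out : p.Prime).pos l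
  exact word_mem_admissibleSpan_of_bounded p K _ l hK rfl

theorem Q0_zero_le_admissibleSpan : Subalgebra.toSubmodule (Q0 p 0) ≤ admissibleSpan p := by
  have h : ∀ x ∈ Q0 p 0, x ∈ Submodule.span (ZMod p) (Set.range (word p)) := by
    intro x hx
    rw [Q0, ← Subalgebra.mem_toSubmodule, Algebra.adjoin_eq_span] at hx
    refine Submodule.span_mono ?_ hx
    intro y hy
    induction hy using Submonoid.closure_induction with
    | mem y hy =>
      obtain ⟨h, rfl⟩ := hy
      exact ⟨[idx p 0 h], by simp⟩
    | one => exact ⟨[], rfl⟩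
    | mul y y' _ _ hy hy' =>
      obtain ⟨l, rfl⟩ := hy
      obtain ⟨l', rfl⟩ := hy'
      exact ⟨l ++ l', by simp⟩
  intro x hx
  refine Submodule.span_le.2 ?_ (h x hx)
  rintro _ ⟨l, rfl⟩
  exact word_mem_admissibleSpan p l

end Span

/-! ### The endomorphism `z_{0,k} ↦ z_{0,pk-1}` -/

section Endomorphism

variable (p : ℕ) [Fact p.Prime]

/-- Lucas' congruence for one digit. -/
theorem ibinom_lucas (M : ℤ) (j : ℕ) {r s : ℕ} (hr : r < p) (hs : s < p) :
    (ibinom (p * M + r) (p * j + s) : ZMod p) = ibinom M j * r.choose s := by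
  have hp := (Fact.out : p.Prime).pos
  rcases lt_or_ge M 0 with hM | hM
  · have : (p : ℤ) * M + r < 0 := by nlinarith
    simp [ibinom, not_le.2 hM, not_le.2 this]
  · obtain ⟨m, rfl⟩ := Int.eq_ofNat_of_zero_le hM
    have e : ((p : ℤ) * m + r) = ((p * m + r : ℕ) : ℤ) := by push_cast; ring
    rw [e, ibinom, ibinom, if_pos (Int.natCast_nonneg _), if_pos hM, Int.toNat_natCast,
      Int.toNat_natCast]
    have h := (ZMod.natCast_eq_natCast_iff _ _ p).2
      (Choose.choose_modEq_choose_mod_mul_choose_div_nat (n := p * m + r) (k := p * j + s) (p := p))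
    rw [h, Nat.mul_add_mod, Nat.mul_add_mod, Nat.mod_eq_of_lt hr, Nat.mod_eq_of_lt hs,
      Nat.mul_add_div hp, Nat.mul_add_div hp, Nat.div_eq_of_lt hr, Nat.div_eq_of_lt hs,
      add_zero, add_zero]
    push_cast
    ring

theorem ademCoeff_mul_mul (hp : p ≠ 2) (n j : ℕ) :
    ademCoeff p (p * n) (p * j) = ademCoeff p n j := by
  have h0 := (Fact.out : p.Prime).pos
  have hodd : Odd p := (Fact.out : p.Prime).odd_of_ne_two hp
  have h := ibinom_lucas p (((p : ℤ) - 1) * ((n : ℤ) - j) - 1) j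
    (show p - 1 < p by omega) h0
  have e : ((p : ℤ) - 1) * (((p * n : ℕ) : ℤ) - ((p * j : ℕ) : ℤ)) - 1
      = p * (((p : ℤ) - 1) * ((n : ℤ) - j) - 1) + ((p - 1 : ℕ) : ℤ) := by
    push_cast [Nat.cast_sub (show 1 ≤ p from h0)]
    ring
  rw [add_zero] at h
  rw [ademCoeff, ademCoeff, e, h, pow_mul, hodd.neg_one_pow]
  simp

theorem ademCoeff_mul_of_not_dvd (n : ℕ) {j : ℕ} (hj : ¬ p ∣ j) : ademCoeff p (p * n) j = 0 := by
  have h0 := (Fact.out : p.Prime).pos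
  have hs : 0 < j % p := Nat.pos_of_ne_zero fun h => hj (Nat.dvd_of_mod_eq_zero h)
  have hlt : j % p < p := Nat.mod_lt _ h0
  have h := ibinom_lucas p (((p : ℤ) - 1) * ((n : ℤ) - (j / p : ℕ)) - (j % p : ℕ)) (j / p)
    (show j % p - 1 < p by omega) hlt
  have hj' : (j : ℤ) = p * (j / p : ℕ) + (j % p : ℕ) := by exact_mod_cast (Nat.div_add_mod j p).symm
  have e : ((p : ℤ) - 1) * (((p * n : ℕ) : ℤ) - (j : ℤ)) - 1
      = p * (((p : ℤ) - 1) * ((n : ℤ) - (j / p : ℕ)) - (j % p : ℕ)) + ((j % p - 1 : ℕ) : ℤ) := by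
    rw [hj', Nat.cast_sub (show 1 ≤ j % p from hs)]
    push_cast
    ring
  rw [Nat.div_add_mod, ← e, Nat.choose_eq_zero_of_lt (by omega), Nat.cast_zero, mul_zero] at h
  rw [ademCoeff, h, mul_zero]

theorem sum_ademCoeff_mul {B : Type*} [AddCommMonoid B] [Module (ZMod p) B] (hp : p ≠ 2) (n : ℕ)
    (F : ℕ → B) : ∑ j ∈ Finset.range (p * n + 1), ademCoeff p (p * n) j • F j
      = ∑ j ∈ Finset.range (n + 1), ademCoeff p n j • F (p * j) := by
  have h0 := (Fact.out : p.Prime).pos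
  rw [← Finset.sum_subset (s₁ := (Finset.range (n + 1)).image (p * ·))]
  · rw [Finset.sum_image fun a _ b _ h => Nat.eq_of_mul_eq_mul_left h0 h]
    exact Finset.sum_congr rfl fun j _ => by rw [ademCoeff_mul_mul p hp]
  · intro j hj
    obtain ⟨i, hi, rfl⟩ := Finset.mem_image.1 hj
    rw [Finset.mem_range, Nat.lt_succ_iff] at hi ⊢
    exact Nat.mul_le_mul_left p hi
  · intro j hj hj'
    rw [ademCoeff_mul_of_not_dvd p n, zero_smul]
    rintro ⟨i, rfl⟩
    rw [Finset.mem_range, Nat.lt_succ_iff] at hj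
    exact hj' (Finset.mem_image.2 ⟨i, by
      rw [Finset.mem_range, Nat.lt_succ_iff]; exact Nat.le_of_mul_le_mul_left hj h0, rfl⟩)

variable {p} (hp : p ≠ 2)

/-- The endomorphism of `𝒬(p)` with `z_{0,k} ↦ z_{0,pk-1}` and `z_{1,k} ↦ 0`. It sends `R(0,k,n)` to
`R(0,pk-1,pn)`. -/
noncomputable def phiQ : Q p →ₐ[ZMod p] Q p :=
  liftQ p (evenFamily fun k => z p 0 (p * k - 1))
    (evenFamily_satisfiesR p _ fun k n => by
      have h := z_satisfiesR p 0 (p * k - 1) (p * n)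
      rw [sum_ademCoeff_mul p hp] at h
      have e1 : ∀ j : ℕ, (p : ℤ) * (p * k - 1) - 1 - ((p * j : ℕ) : ℤ) = p * (p * k - 1 - j) - 1 :=
        fun j => by push_cast; ring
      have e2 : ∀ j : ℕ, (p : ℤ) * k - 1 - ((p * n : ℕ) : ℤ) + ((p * j : ℕ) : ℤ)
          = p * (k - n + j) - 1 := fun j => by push_cast; ring
      simpa only [e1, e2] using h)
    (evenFamily_satisfiesS p _)

theorem phiQ_z (k : ℤ) : phiQ hp (z p 0 k) = z p 0 (p * k - 1) := by
  rw [phiQ, liftQ_z]; rfl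

theorem phiQ_word (l : List ℤ) : phiQ hp (word p l) = word p (l.map fun i => p * i - 1) := by
  induction l with
  | nil => simp
  | cons i t ih => rw [word_cons, map_mul, phiQ_z, ih, List.map_cons, word_cons]

theorem admissible_map {l : List ℤ} (h : Admissible p l) :
    Admissible p (l.map fun i => p * i - 1) := by
  have hp := (Fact.out : p.Prime).pos
  rw [Admissible, List.isChain_map]
  refine List.IsChain.imp (fun a b hab => ?_) h
  have : (p : ℤ) * (p * b) ≤ p * a := mul_le_mul_of_nonneg_left hab (by positivity)
  rw [mul_sub]
  omega

/-- `phiQ` sends the admissible words to different admissible words. -/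
theorem phiQ_injOn_admissibleSpan : Set.InjOn (phiQ hp) (admissibleSpan p) := by
  intro x hx y hy hxy
  obtain ⟨f, rfl⟩ := Finsupp.mem_span_range_iff_exists_finsupp.1 hx
  obtain ⟨g, rfl⟩ := Finsupp.mem_span_range_iff_exists_finsupp.1 hy
  have hinj : Function.Injective fun l : {l : List ℤ // Admissible p l} =>
      (⟨_, admissible_map l.2⟩ : {l : List ℤ // Admissible p l}) := by
    intro l l' h
    have h' := congrArg Subtype.val h
    refine Subtype.ext (List.map_injective_iff.2 (fun a b hab => ?_) h')
    have h0 : (p : ℤ) ≠ 0 := by exact_mod_cast (Fact.out : p.Prime).ne_zero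
    exact mul_left_cancel₀ h0 (sub_left_injective hab)
  have hfg : f = g := (linearIndependent_word p).comp _ hinj (by
    simp only [Finsupp.linearCombination_apply]
    simp only [Finsupp.sum, map_sum, map_smul, phiQ_word] at hxy
    exact hxy)
  rw [hfg]

end Endomorphism

/-! ### Exchanging the first letters `z_{0,k}` and `z_{1,k}` -/

section Exchange

variable (p : ℕ)

theorem mon_eq (i : ℤ) (l : List ℤ) : mon p i l = z p 1 i * word p l := rfl

/-- The family `z_{0,k}`, `z_{0,k} ε` of dual numbers. -/
noncomputable def dualFamily : Fin 2 → ℤ → DualNumber (Q p) := fun ε k =>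
  if ε = 0 then TrivSqZeroExt.inl (z p 0 k) else TrivSqZeroExt.inr (z p 0 k)

theorem dualFamily_zero (k : ℤ) : dualFamily p 0 k = TrivSqZeroExt.inl (z p 0 k) := rfl

theorem dualFamily_one (k : ℤ) : dualFamily p 1 k = TrivSqZeroExt.inr (z p 0 k) := rfl

variable [Fact p.Prime]

theorem ademCoeff_add_ademCoeffBockstein (n j : ℕ) (hj : j ≤ n) :
    ademCoeff p (n + 1) (j + 1) + ademCoeffBockstein p (n + 1) (j + 1) = ademCoeff p n j := by
  have h2 := (Fact.out : p.Prime).two_le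
  obtain ⟨i, rfl⟩ := Nat.exists_eq_add_of_le hj
  have e1 : ((p : ℤ) - 1) * (((j + i + 1 : ℕ) : ℤ) - ((j + 1 : ℕ) : ℤ)) = (((p - 1) * i : ℕ) : ℤ) := by
    push_cast [Nat.cast_sub (show 1 ≤ p by omega)]
    ring
  have e2 : ((p : ℤ) - 1) * (((j + i : ℕ) : ℤ) - (j : ℤ)) = (((p - 1) * i : ℕ) : ℤ) := by
    push_cast [Nat.cast_sub (show 1 ≤ p by omega)]
    ring
  rw [ademCoeff, ademCoeffBockstein, ademCoeff, e1, e2]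
  rcases Nat.eq_zero_or_pos ((p - 1) * i) with h | h
  · simp [h, ibinom]
  · obtain ⟨N, hN⟩ : ∃ N, (p - 1) * i = N + 1 := ⟨(p - 1) * i - 1, by omega⟩
    rw [hN]
    have e3 : (((N + 1 : ℕ) : ℤ) - 1) = (N : ℤ) := by push_cast; ring
    rw [e3, ibinom, ibinom, ibinom, if_pos (by positivity), if_pos (by positivity),
      if_pos (by positivity), Int.toNat_natCast, Int.toNat_natCast, Nat.choose_succ_succ]
    push_cast
    ring

theorem dualFamily_satisfiesR : SatisfiesR p (dualFamily p) := by
  intro ε k n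
  unfold dualFamily
  have h := z_satisfiesR p 0 k n
  by_cases hε : ε = 0
  · simp only [hε, if_true, ← TrivSqZeroExt.inl_mul, ← TrivSqZeroExt.inl_smul,
      ← TrivSqZeroExt.inl_sum, ← TrivSqZeroExt.inl_add, h, TrivSqZeroExt.inl_zero]
  · ext
    · simp [hε, TrivSqZeroExt.fst_sum]
    · simpa [hε, TrivSqZeroExt.snd_sum] using h

/-- By Pascal's rule, `S(0,k,n+1)` becomes `R(0,k,n) ε`. -/
theorem dualFamily_satisfiesS : SatisfiesS p (dualFamily p) := by
  intro ε k n
  unfold dualFamily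
  by_cases hε : ε = 0
  · ext
    · simp [hε, TrivSqZeroExt.fst_sum]
    · simp only [hε, if_true, TrivSqZeroExt.snd_add, TrivSqZeroExt.snd_sum,
        TrivSqZeroExt.snd_smul, TrivSqZeroExt.snd_mul, TrivSqZeroExt.fst_inl,
        TrivSqZeroExt.snd_inl, TrivSqZeroExt.fst_inr, TrivSqZeroExt.snd_inr,
        one_ne_zero, if_false, smul_eq_mul, op_smul_eq_mul, mul_zero, add_zero, zero_add,
         TrivSqZeroExt.snd_zero]
      rw [add_assoc, ← Finset.sum_add_distrib]
      simp only [← add_smul]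
      rcases n with _ | n
      · simp [ademCoeff, ademCoeffBockstein, ibinom]
      · have h := z_satisfiesR p 0 k n
        rw [Finset.sum_range_succ', ← h]
        have h0 : ademCoeff p (n + 1) 0 + ademCoeffBockstein p (n + 1) 0 = 0 := by
          have h2 := (Fact.out : p.Prime).two_le
          have a : (1 : ℤ) ≤ ((p : ℤ) - 1) * (n + 1) :=
            one_le_mul_of_one_le_of_one_le (by omega) (by omega)
          have b : (0 : ℤ) ≤ ((p : ℤ) - 1) * (n + 1) := by omega
          simp [ademCoeff, ademCoeffBockstein, ibinom, a, b]
        rw [h0, zero_smul, add_zero]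
        congr 1
        · congr 2; push_cast; ring
        · refine Finset.sum_congr rfl fun j hj => ?_
          rw [ademCoeff_add_ademCoeffBockstein p n j
            (Nat.lt_succ_iff.1 (Finset.mem_range.1 hj))]
          congr 3 <;> · push_cast; ring
  · simp only [hε, if_false, one_ne_zero, TrivSqZeroExt.inr_mul_inr, smul_zero,
      Finset.sum_const_zero, add_zero]

/-- The homomorphism to the dual numbers with `z_{0,k} ↦ z_{0,k}` and `z_{1,k} ↦ z_{0,k} ε`. -/
noncomputable def dualHom : Q p →ₐ[ZMod p] DualNumber (Q p) :=
  liftQ p (dualFamily p) (dualFamily_satisfiesR p) (dualFamily_satisfiesS p)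

/-- The homomorphism to `2 × 2` matrices with `z_{0,k} ↦ !![0, z_{1,k}; 0, z_{0,k}]` and
`z_{1,k} ↦ 0`. -/
noncomputable def matrixHom : Q p →ₐ[ZMod p] Matrix (Fin 2) (Fin 2) (Q p) :=
  liftQ p (evenFamily fun k => !![0, z p 1 k; 0, z p 0 k])
    (evenFamily_satisfiesR p _ fun k n => by
      have h0 := z_satisfiesR p 0 k n
      have h1 := z_satisfiesR p 1 k n
      ext i j
      fin_cases i <;> fin_cases j <;> simp [Matrix.sum_apply, h0, h1])
    (evenFamily_satisfiesS p _)

/-- The linear map sending `z_{1,i₁} z_{0,i₂} ⋯ z_{0,i_m}` to `z_{0,i₁} z_{0,i₂} ⋯ z_{0,i_m}`. -/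
noncomputable def lowerHead : Q p →ₗ[ZMod p] Q p :=
  TrivSqZeroExt.sndHom (Q p) (Q p) |>.restrictScalars (ZMod p) |>.comp (dualHom p).toLinearMap

/-- The linear map sending `z_{0,i₁} z_{0,i₂} ⋯ z_{0,i_m}` to `z_{1,i₁} z_{0,i₂} ⋯ z_{0,i_m}`. -/
noncomputable def raiseHead : Q p →ₗ[ZMod p] Q p :=
  Matrix.entryLinearMap (ZMod p) (Q p) 0 1 ∘ₗ (matrixHom p).toLinearMap

theorem lowerHead_mon (i : ℤ) (l : List ℤ) : lowerHead p (mon p i l) = word p (i :: l) := by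
  have h : dualHom p (word p l) = TrivSqZeroExt.inl (word p l) := by
    induction l with
    | nil => simp
    | cons i l ih =>
      rw [word_cons, map_mul, ih, dualHom, liftQ_z, dualFamily_zero, TrivSqZeroExt.inl_mul]
  have h1 : dualHom p (z p 1 i) = TrivSqZeroExt.inr (z p 0 i) := by
    rw [dualHom, liftQ_z, dualFamily_one]
  change (dualHom p (mon p i l)).snd = _
  rw [mon_eq, map_mul, h, h1]
  simp

theorem raiseHead_word (i : ℤ) (l : List ℤ) : raiseHead p (word p (i :: l)) = mon p i l := by
  have hz : ∀ i, matrixHom p (z p 0 i) = !![0, z p 1 i; 0, z p 0 i] := fun i => by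
    rw [matrixHom, liftQ_z]; rfl
  have h : matrixHom p (word p l) 1 1 = word p l := by
    induction l with
    | nil => simp
    | cons i l ih => simp [hz, Matrix.mul_apply, Fin.sum_univ_two, ih]
  change matrixHom p (word p (i :: l)) 0 1 = _
  simp [hz, Matrix.mul_apply, Fin.sum_univ_two, h, mon_eq]

variable {p} (hp : p ≠ 2)

/-- The linear map with
`z_{1,i₁} z_{0,i₂} ⋯ z_{0,i_m} ↦ z_{1,pi₁-1} z_{0,pi₂-1} ⋯ z_{0,pi_m-1}`. -/
noncomputable def lamQ : Q p →ₗ[ZMod p] Q p :=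
  raiseHead p ∘ₗ (phiQ hp).toLinearMap ∘ₗ lowerHead p

theorem lamQ_mon (i : ℤ) (l : List ℤ) :
    lamQ hp (mon p i l) = mon p (p * i - 1) (l.map fun i => p * i - 1) := by
  change raiseHead p (phiQ hp (lowerHead p (mon p i l))) = _
  rw [lowerHead_mon, phiQ_word, List.map_cons, raiseHead_word]

theorem V_zero_eq : V p 0 = Submodule.span (ZMod p)
    {x | ∃ (h : ℤ) (l : List ℤ), l ≠ [] ∧ x = mon p h l} := by
  have h : idx p 0 = id := funext (idx_zero p)
  simp [V, h]

/-- `lamQ` is `phiQ` seen through the injection `lowerHead` of `V_0` into `𝒬_0^0`. -/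
theorem lowerHead_lamQ {x : Q p} (hx : x ∈ V p 0) :
    raiseHead p (lowerHead p x) = x ∧ lowerHead p x ∈ admissibleSpan p ∧
      lowerHead p (lamQ hp x) = phiQ hp (lowerHead p x) := by
  rw [V_zero_eq] at hx
  induction hx using Submodule.span_induction with
  | mem x hx =>
    obtain ⟨i, l, -, rfl⟩ := hx
    rw [lamQ_mon, lowerHead_mon, lowerHead_mon, phiQ_word]
    exact ⟨raiseHead_word p i l, word_mem_admissibleSpan p _, rfl⟩
  | zero => simp
  | add x y _ _ hx hy =>
    simp only [map_add, hx.1, hy.1, hx.2.2, hy.2.2, true_and, and_true]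
    exact add_mem hx.2.1 hy.2.1
  | smul a x _ hx =>
    simp only [map_smul, hx.1, hx.2.2, true_and, and_true]
    exact Submodule.smul_mem _ _ hx.2.1

theorem lamQ_injOn : Set.InjOn (lamQ hp) (V p 0) := by
  intro x hx y hy hxy
  obtain ⟨h1, h2, h3⟩ := lowerHead_lamQ hp hx
  obtain ⟨h4, h5, h6⟩ := lowerHead_lamQ hp hy
  rw [← h1, ← h4, phiQ_injOn_admissibleSpan hp h2 h5 (by rw [← h3, ← h6, hxy])]

theorem phiQ_injOn : Set.InjOn (phiQ hp) (Q0 p 0) := fun _ hx _ hy h =>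
  phiQ_injOn_admissibleSpan hp (Q0_zero_le_admissibleSpan p hx) (Q0_zero_le_admissibleSpan p hy) h

theorem lamQ_mul {v q : Q p} (hv : v ∈ V p 0) (hq : q ∈ Q0 p 0) :
    lamQ hp (v * q) = lamQ hp v * phiQ hp q := by
  induction hq using Algebra.adjoin_induction generalizing v with
  | mem x hx =>
    obtain ⟨k, rfl⟩ := hx
    rw [V_zero_eq] at hv
    induction hv using Submodule.span_induction with
    | mem y hy =>
      obtain ⟨i, l, -, rfl⟩ := hy
      have : mon p i l * z p 0 (idx p 0 k) = mon p i (l ++ [idx p 0 k]) := by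
        simp [mon, mul_assoc]
      simp only [this, lamQ_mon, phiQ_z]
      simp [mon, mul_assoc]
    | zero => simp
    | add x y _ _ hx hy => rw [add_mul, map_add, map_add, add_mul, hx, hy]
    | smul a x _ hx => rw [smul_mul_assoc, map_smul, map_smul, smul_mul_assoc, hx]
  | algebraMap r =>
    rw [← Algebra.commutes, ← Algebra.smul_def, map_smul, AlgHom.commutes, ← Algebra.commutes,
      ← Algebra.smul_def]
  | add x y _ _ hx hy => rw [mul_add, map_add, map_add, mul_add, hx hv, hy hv]
  | mul x y hx' _ hx hy =>
    rw [← mul_assoc, hy (mul_mem_V hv hx'), hx hv, map_mul, mul_assoc]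

/-! ### The chain of pairs -/

theorem alpha_succ (s : ℕ) : alpha p (s + 1) = alpha p s + p ^ s := by
  have h2 := (Fact.out : p.Prime).two_le
  have e : ∀ s, alpha p s = ∑ i ∈ Finset.range s, p ^ i := fun s => (Nat.geomSum_eq h2 s).symm
  rw [e, e, Finset.sum_range_succ]

theorem idx_succ_eq_idx (s : ℕ) (h : ℤ) : idx p (s + 1) h = idx p s (p * h - 1) := by
  rw [idx, idx, alpha_succ]
  push_cast
  ring

theorem idx_succ (s : ℕ) (h : ℤ) : idx p (s + 1) h = p * idx p s h - 1 := by
  induction s generalizing h with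
  | zero => rw [idx_succ_eq_idx, idx_zero, idx_zero]
  | succ s ih => rw [idx_succ_eq_idx, ih, ← idx_succ_eq_idx]

theorem V_succ_le (s : ℕ) : V p (s + 1) ≤ V p s := by
  refine Submodule.span_mono ?_
  rintro x ⟨h, l, hl, rfl⟩
  refine ⟨p * h - 1, l.map fun h => p * h - 1, by simpa using hl, ?_⟩
  rw [idx_succ_eq_idx, List.map_map]
  congr 1
  exact List.map_congr_left fun a _ => idx_succ_eq_idx s a

theorem Q0_succ_le (s : ℕ) : Q0 p (s + 1) ≤ Q0 p s := by
  refine Algebra.adjoin_mono ?_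
  rintro x ⟨h, rfl⟩
  exact ⟨p * h - 1, by simp only [idx_succ_eq_idx]⟩

theorem map_lamQ_V (s : ℕ) : (V p s).map (lamQ hp) = V p (s + 1) := by
  have e : ∀ l : List ℤ, (l.map (idx p s)).map (fun i => (p : ℤ) * i - 1) = l.map (idx p (s + 1)) :=
    fun l => by
      rw [List.map_map]
      exact List.map_congr_left fun a _ => (idx_succ s a).symm
  rw [V, V, Submodule.map_span]
  congr 1
  ext x
  constructor
  · rintro ⟨_, ⟨h, l, hl, rfl⟩, rfl⟩
    exact ⟨h, l, hl, by rw [lamQ_mon, ← idx_succ, e]⟩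
  · rintro ⟨h, l, hl, rfl⟩
    exact ⟨_, ⟨h, l, hl, rfl⟩, by rw [lamQ_mon, ← idx_succ, e]⟩

theorem map_phiQ_Q0 (s : ℕ) : (Q0 p s).map (phiQ hp) = Q0 p (s + 1) := by
  rw [Q0, Q0, AlgHom.map_adjoin, ← Set.range_comp]
  congr 2
  funext h
  rw [Function.comp_apply, phiQ_z, idx_succ]

variable (p) in
/-- The character with `z_{0,0} ↦ X` that kills all other generators. It kills every `z_{0,pk-1}`,
and hence separates `(V_0, 𝒬_0^0)` from `(V_1, 𝒬_1^0)`. -/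
noncomputable def zeroChar : Q p →ₐ[ZMod p] Polynomial (ZMod p) :=
  liftQ p (evenFamily fun k => if k = 0 then Polynomial.X else 0)
    (evenFamily_satisfiesR p _ fun k n => by
      have h1 : ¬ (p * k - 1 - (n : ℤ) = 0 ∧ k = 0) := by
        rintro ⟨h, rfl⟩
        rw [mul_zero] at h
        omega
      have h2 : ∀ a b : ℤ, ¬ (a = 0 ∧ b = 0) → (if a = 0 then Polynomial.X else 0) *
          (if b = 0 then Polynomial.X else 0) = (0 : Polynomial (ZMod p)) := by
        intro a b h
        by_cases ha : a = 0
        · simp [show b ≠ 0 from fun hb => h ⟨ha, hb⟩]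
        · simp [ha]
      rw [h2 _ _ h1, zero_add]
      refine Finset.sum_eq_zero fun j _ => ?_
      by_cases h : p * k - 1 - (j : ℤ) = 0 ∧ k - n + j = 0
      · have hk : (n : ℤ) - j = k := by omega
        -- Here `j = pk - 1` and `n - j = k`, so that the coefficient is `((p-1)k-1 choose pk-1) = 0`.
        have hkpos : 0 < k := by
          by_contra hk0
          have : (p : ℤ) * k ≤ 0 := mul_nonpos_of_nonneg_of_nonpos (by positivity) (by omega)
          omega
        have : ibinom (((p : ℤ) - 1) * ((n : ℤ) - j) - 1) j = 0 := by
          rw [hk, ibinom]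
          split_ifs
          · apply Nat.choose_eq_zero_of_lt
            have : ((p : ℤ) - 1) * k = p * k - k := by ring
            omega
          · rfl
        rw [ademCoeff, this]
        simp
      · rw [h2 _ _ h, smul_zero])
    (evenFamily_satisfiesS p _)

theorem zeroChar_z (k : ℤ) :
    zeroChar p (z p 0 k) = if k = 0 then Polynomial.X else 0 := by
  rw [zeroChar, liftQ_z]; rfl

theorem zeroChar_z_idx_one (h : ℤ) : zeroChar p (z p 0 (idx p 1 h)) = 0 := by
  rw [zeroChar_z, if_neg]
  rw [idx_succ, idx_zero]
  intro h0
  have : (p : ℤ) ∣ 1 := ⟨h, by omega⟩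
  exact (Fact.out : p.Prime).one_lt.ne' (by exact_mod_cast Int.eq_one_of_dvd_one (by positivity) this)

theorem V_one_ne : V p 1 ≠ V p 0 := by
  intro h
  have h1 : ∀ x ∈ V p 1, zeroChar p (lowerHead p x) = 0 := by
    intro x hx
    induction hx using Submodule.span_induction with
    | mem x hx =>
      obtain ⟨i, l, -, rfl⟩ := hx
      rw [lowerHead_mon, word_cons, map_mul, zeroChar_z_idx_one, zero_mul]
    | zero => simp
    | add x y _ _ hx hy => rw [map_add, map_add, hx, hy, add_zero]
    | smul a x _ hx => rw [map_smul, map_smul, hx, smul_zero]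
  have h2 := h1 (mon p 0 [0]) (h ▸ mon_mem_V_zero p 0 [0] (by simp))
  rw [lowerHead_mon] at h2
  simp [zeroChar_z] at h2

theorem Q0_one_ne : Q0 p 1 ≠ Q0 p 0 := by
  intro h
  have h1 : Q0 p 1 ≤ (⊥ : Subalgebra (ZMod p) (Polynomial (ZMod p))).comap (zeroChar p) := by
    refine Algebra.adjoin_le ?_
    rintro _ ⟨k, rfl⟩
    simp only [SetLike.mem_coe, Subalgebra.mem_comap, zeroChar_z_idx_one]
    exact zero_mem _
  have h2 := h1 (h ▸ z_mem_Q0_zero p 0)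
  rw [Subalgebra.mem_comap, zeroChar_z, if_pos rfl, Algebra.mem_bot] at h2
  obtain ⟨a, ha⟩ := h2
  have := congrArg (fun f : Polynomial (ZMod p) => f.coeff 1) ha
  simp [Polynomial.algebraMap_eq] at this

include hp in
theorem V_succ_ne (s : ℕ) : V p (s + 1) ≠ V p s := by
  induction s with
  | zero => exact V_one_ne
  | succ s ih =>
    intro h
    apply ih
    refine le_antisymm (V_succ_le s) fun x hx => ?_
    have h1 : lamQ hp x ∈ (V p (s + 1)).map (lamQ hp) := by
      rw [map_lamQ_V, h, ← map_lamQ_V hp]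
      exact Submodule.mem_map_of_mem hx
    obtain ⟨y, hy, hxy⟩ := h1
    rwa [← lamQ_injOn hp (V_le_V_zero p _ hy) (V_le_V_zero p _ hx) hxy]

include hp in
theorem Q0_succ_ne (s : ℕ) : Q0 p (s + 1) ≠ Q0 p s := by
  induction s with
  | zero => exact Q0_one_ne
  | succ s ih =>
    intro h
    apply ih
    refine le_antisymm (Q0_succ_le s) fun x hx => ?_
    have h1 : phiQ hp x ∈ (Q0 p (s + 1)).map (phiQ hp) := by
      rw [map_phiQ_Q0, h, ← map_phiQ_Q0 hp]
      exact ⟨x, hx, rfl⟩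
    obtain ⟨y, hy, hxy⟩ := h1
    rwa [← phiQ_injOn hp (Q0_le_Q0_zero p _ hy) (Q0_le_Q0_zero p _ hx) hxy]

end Exchange

end UnivSteenrod

/-! ### Isomorphisms of pairs -/

namespace RightModPair

/-- A morphism of pairs with bijective components is an isomorphism. -/
noncomputable def isoOfBijective {X Y : RightModPair} (h : X ⟶ Y) (hf : Function.Bijective h.f)
    (hω : Function.Bijective h.ω) : X ≅ Y where
  hom := h
  inv :=
    { f := (AddEquiv.ofBijective h.f hf).symm
      ω := (RingEquiv.ofBijective h.ω hω).symm
      map_smul := fun m r => by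
        obtain ⟨m, rfl⟩ := hf.2 m
        obtain ⟨r, rfl⟩ := hω.2 r
        rw [← h.map_smul]
        have e1 : ∀ x, (AddEquiv.ofBijective h.f hf).symm (h.f x) = x :=
          (AddEquiv.ofBijective h.f hf).symm_apply_apply
        have e2 : ∀ x, (RingEquiv.ofBijective h.ω hω).symm (h.ω x) = x :=
          (RingEquiv.ofBijective h.ω hω).symm_apply_apply
        simp only [AddMonoidHom.coe_coe, RingHom.coe_coe, e1, e2] }
  hom_inv_id := Hom.ext
    (AddMonoidHom.ext (AddEquiv.ofBijective h.f hf).symm_apply_apply)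
    (RingHom.ext (RingEquiv.ofBijective h.ω hω).symm_apply_apply)
  inv_hom_id := Hom.ext
    (AddMonoidHom.ext (AddEquiv.ofBijective h.f hf).apply_symm_apply)
    (RingHom.ext (RingEquiv.ofBijective h.ω hω).apply_symm_apply)

end RightModPair

namespace UnivSteenrod

section Pairs

variable {p : ℕ} [Fact p.Prime]

/-- The inclusion `(V_{s+1}, 𝒬_{s+1}^0) → (V_s, 𝒬_s^0)`. -/
noncomputable def pairIncl (s : ℕ) : pair p (s + 1) ⟶ pair p s where
  f :=
    { toFun := fun v : V p (s + 1) => (⟨v, V_succ_le s v.2⟩ : V p s)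
      map_zero' := rfl
      map_add' := fun _ _ => rfl }
  ω := (Subalgebra.inclusion (Q0_succ_le s) : Q0 p (s + 1) →ₐ[ZMod p] Q0 p s).toRingHom
  map_smul _ _ := rfl

theorem coe_pairIncl_f (s : ℕ) (v : V p (s + 1)) :
    (V p s).subtype ((pairIncl s).f v) = (v : Q p) :=
  congrArg (V p s).subtype
    (show (pairIncl s).f v = (⟨v, V_succ_le s v.2⟩ : V p s) from rfl)

theorem coe_pairIncl_ω (s : ℕ) (q : Q0 p (s + 1)) :
    (Q0 p s).val ((pairIncl s).ω q) = (q : Q p) :=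
  congrArg (Q0 p s).val
    (show (pairIncl s).ω q = (⟨q, Q0_succ_le s q.2⟩ : Q0 p s) from rfl)

variable (hp : p ≠ 2)

theorem lamQ_mem {s : ℕ} {v : Q p} (hv : v ∈ V p s) : lamQ hp v ∈ V p (s + 1) :=
  map_lamQ_V hp s ▸ Submodule.mem_map_of_mem hv

theorem phiQ_mem {s : ℕ} {q : Q p} (hq : q ∈ Q0 p s) : phiQ hp q ∈ Q0 p (s + 1) :=
  map_phiQ_Q0 hp s ▸ ⟨q, hq, rfl⟩

/-- The restriction of `(lamQ, phiQ)` to a morphism `(V_s, 𝒬_s^0) → (V_{s+1}, 𝒬_{s+1}^0)`. -/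
noncomputable def pairHom (s : ℕ) : pair p s ⟶ pair p (s + 1) where
  f :=
    { toFun := fun v : V p s => (⟨lamQ hp v, lamQ_mem hp v.2⟩ : V p (s + 1))
      map_zero' := Subtype.ext (map_zero (lamQ hp))
      map_add' := fun v w => Subtype.ext (map_add (lamQ hp) (v : V p s).1 (w : V p s).1) }
  ω := (((phiQ hp).comp (Q0 p s).val).codRestrict (Q0 p (s + 1))
    fun q => phiQ_mem hp q.2 : Q0 p s →ₐ[ZMod p] Q0 p (s + 1)).toRingHom
  map_smul v q := Subtype.ext
    (lamQ_mul hp (V_le_V_zero p s (v : V p s).2) (Q0_le_Q0_zero p s (q : Q0 p s).2))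

/-- The isomorphism `(V_s, 𝒬_s^0) ≅ (V_{s+1}, 𝒬_{s+1}^0)` given by `(lamQ, phiQ)`. -/
noncomputable def pairIso (s : ℕ) : pair p s ≅ pair p (s + 1) :=
  RightModPair.isoOfBijective (pairHom hp s)
    ⟨fun v w h => Subtype.ext (lamQ_injOn hp (V_le_V_zero p s (v : V p s).2)
        (V_le_V_zero p s (w : V p s).2) (congrArg Subtype.val h)),
      fun v => by
        have hv : (v : V p (s + 1)).1 ∈ (V p s).map (lamQ hp) := by
          rw [map_lamQ_V]; exact (v : V p (s + 1)).2
        obtain ⟨x, hx, hxv⟩ := hv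
        exact ⟨(⟨x, hx⟩ : V p s), Subtype.ext hxv⟩⟩
    ⟨fun v w h => Subtype.ext (phiQ_injOn hp (Q0_le_Q0_zero p s (v : Q0 p s).2)
        (Q0_le_Q0_zero p s (w : Q0 p s).2) (congrArg Subtype.val h)),
      fun v => by
        have hv : (v : Q0 p (s + 1)).1 ∈ (Q0 p s).map (phiQ hp) := by
          rw [map_phiQ_Q0]; exact (v : Q0 p (s + 1)).2
        obtain ⟨x, hx, hxv⟩ := hv
        exact ⟨(⟨x, hx⟩ : Q0 p s), Subtype.ext hxv⟩⟩

theorem coe_pairIso_f (s : ℕ) (v : V p s) :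
    (V p (s + 1)).subtype ((pairIso hp s).hom.f v) = lamQ hp v := rfl

theorem coe_pairIso_ω (s : ℕ) (q : Q0 p s) :
    (Q0 p (s + 1)).val ((pairIso hp s).hom.ω q) = phiQ hp q := rfl

/-- The map `λ : V_0 → V_0`. -/
noncomputable def lamV : V p 0 →ₗ[ZMod p] V p 0 :=
  (lamQ hp).restrict fun _ hv => V_succ_le 0 (lamQ_mem hp hv)

theorem coe_lamV (v : V p 0) : (lamV hp v : Q p) = lamQ hp v := rfl

/-- The map `φ : 𝒬_0^0 → 𝒬_0^0`. -/
noncomputable def phiQ0 : Q0 p 0 →ₐ[ZMod p] Q0 p 0 :=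
  ((phiQ hp).comp (Q0 p 0).val).codRestrict (Q0 p 0) fun q => Q0_succ_le 0 (phiQ_mem hp q.2)

theorem coe_phiQ0 (q : Q0 p 0) : (phiQ0 hp q : Q p) = phiQ hp q := rfl

theorem lamV_injective : Function.Injective (lamV hp) := fun v w h =>
  Subtype.ext (lamQ_injOn hp v.2 w.2 (by rw [← coe_lamV, ← coe_lamV, h]))

theorem phiQ0_injective : Function.Injective (phiQ0 hp) := fun v w h =>
  Subtype.ext (phiQ_injOn hp v.2 w.2 (by rw [← coe_phiQ0, ← coe_phiQ0, h]))

end Pairs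

end UnivSteenrod

theorem theorem4p3 (p : ℕ) [Fact p.Prime] (hp : p ≠ 2) :
    -- the pairs form a descending chain, whose inclusions are morphisms of the category
    (∀ s : ℕ, V p (s + 1) < V p s ∧ Q0 p (s + 1) < Q0 p s ∧
      ∃ i : pair p (s + 1) ⟶ pair p s,
        (∀ v : V p (s + 1), (V p s).subtype (i.f v) = (v : Q p)) ∧
        (∀ q : Q0 p (s + 1), (Q0 p s).val (i.ω q) = (q : Q p))) ∧
    -- all of them are isomorphic
    (∀ s t : ℕ, Nonempty (pair p s ≅ pair p t)) ∧
    -- consecutive pairs are isomorphic through the restrictions of `lam` and `φ`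
    ∃ (lam : V p 0 →ₗ[ZMod p] V p 0) (φ : Q0 p 0 →ₐ[ZMod p] Q0 p 0),
      Function.Injective lam ∧ Function.Injective φ ∧
      (∀ (i₁ : ℤ) (l : List ℤ) (hl : l ≠ []),
        (lam ⟨mon p i₁ l, mon_mem_V_zero p i₁ l hl⟩ : Q p) =
          mon p (p * i₁ - 1) (l.map fun i => p * i - 1)) ∧
      (∀ k : ℤ, (φ ⟨z p 0 k, z_mem_Q0_zero p k⟩ : Q p) = z p 0 (p * k - 1)) ∧
      ∀ s : ℕ, ∃ e : pair p s ≅ pair p (s + 1),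
        (∀ v : V p s,
          (V p (s + 1)).subtype (e.hom.f v) = (lam ⟨v, V_le_V_zero p s v.2⟩ : Q p)) ∧
        (∀ q : Q0 p s,
          (Q0 p (s + 1)).val (e.hom.ω q) = (φ ⟨q, Q0_le_Q0_zero p s q.2⟩ : Q p)) := by
  refine ⟨fun s => ⟨lt_of_le_of_ne (V_succ_le s) (V_succ_ne hp s),
    lt_of_le_of_ne (Q0_succ_le s) (Q0_succ_ne hp s), pairIncl s,
    coe_pairIncl_f s, coe_pairIncl_ω s⟩, ?_, ?_⟩
  · have h : ∀ s, Nonempty (pair p 0 ≅ pair p s) := fun s => by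
      induction s with
      | zero => exact ⟨Iso.refl _⟩
      | succ s ih => exact ih.map fun e => e ≪≫ pairIso hp s
    intro s t
    obtain ⟨e⟩ := h s
    obtain ⟨e'⟩ := h t
    exact ⟨e.symm ≪≫ e'⟩
  · exact ⟨lamV hp, phiQ0 hp, lamV_injective hp, phiQ0_injective hp,
      fun i l _ => (coe_lamV hp _).trans (lamQ_mon hp i l),
      fun k => (coe_phiQ0 hp _).trans (phiQ_z hp k),
      fun s => ⟨pairIso hp s, fun v => (coe_pairIso_f hp s v).trans
          (coe_lamV hp ⟨v, V_le_V_zero p s v.2⟩).symm,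
        fun q => (coe_pairIso_ω hp s q).trans
          (coe_phiQ0 hp ⟨q, Q0_le_Q0_zero p s q.2⟩).symm⟩⟩
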